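/- **Setting.** *Primitive types* are $B ::= \mathsf{number}\mid\mathsf{bool}$, with values the integers and the two booleans. *Primitive constants* $c$ are all total first-order operations $B_1\to\dots\to B_n\to B$ ($n\ge 0$) on these values: literals for $n=0$, curried operators for $n>0$; $[\![c]\!](v)$ is defined exactly when $v$ is a literal of the argument type $B_1$ of the operator $c$, and is again a constant. Terms are taken up to renaming of bound variables. *Source.* Values $v ::= c\mid x\mid\lambda x.e$; expressions $e ::= v\mid \mathsf{let}\,x=e_1\,\mathsf{in}\,e_2\mid \mathsf{if}\ e\ \mathsf{then}\ e_1\ \mathsf{else}\ e_2\mid e_1\,e_2$; evaluation contexts $E ::= [\,]\mid \mathsf{let}\,x=E\,\mathsf{in}\,e\mid\mathsf{if}\ E\ \mathsf{then}\ e_1\ \mathsf{else}\ e_2\mid E\,e\mid v\,E$. The relation $e\longrightarrow e'$ is closed under evaluation contexts and generated by $c\,v\to[\![c]\!](v)$, $(\lambda x.e)\,v\to[v/x]e$, $\mathsf{let}\,x=v\,\mathsf{in}\,e\to[v/x]e$ and the two rules for conditionals on $\mathsf{true}$, $\mathsf{false}$. Types $A ::= B\mid A\to A'\mid A\wedge A'\mid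 A\vee A'$ have tag sets $\mathrm{tag}(\mathsf{number})=\{\text{number}\}$, $\mathrm{tag}(\mathsf{bool})=\{\text{boolean}\}$, $\mathrm{tag}(A\to A')=\{\text{function}\}$, $\mathrm{tag}(A\wedge A')=\mathrm{tag}(A)$, $\mathrm{tag}(A\vee A')=\mathrm{tag}(A)\cup\mathrm{tag}(A')$. A type is well formed if in each $A\wedge A'$ in it $\mathrm{tag}(A)=\mathrm{tag}(A')$ and in each $A\vee A'$ in it $\mathrm{tag}(A)\cap\mathrm{tag}(A')=\emptyset$. *Target.* Expressions $t$ have the source forms and pairs $\langle t_1,t_2\rangle$, $\mathsf{proj}_k t$, $\mathsf{inj}_k t$, $\mathsf{case}\ t\ \mathsf{of}\ x_1.t_1\mid x_2.t_2$ and casts $\mathrm{DEAD}_{A\downarrow A'}(t)$. Values $w$ are $c$, $x$, $\lambda x.t$, $\langle t_1,t_2\rangle$ (any $t_1,t_2$), $\mathsf{inj}_k w$, $\mathrm{DEAD}_{A\downarrow A'}(w)$. Evaluation contexts are as in the source, plus $\mathsf{inj}_k E$, $\mathsf{proj}_k E$, $\mathrm{DEAD}_{A\downarrow A'}(E)$,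 $\mathsf{case}\ E\ \mathsf{of}\dots$; besides the analogues of the source rules, $\mathsf{proj}_k\langle t_1,t_2\rangle\to t_k$ and $\mathsf{case}\ \mathsf{inj}_k w\ \mathsf{of}\ x_1.t_1\mid x_2.t_2\to[w/x_k]t_k$. No rule removes a cast, and $[\![c]\!]$ is undefined on casts. *Elaboration* $\Gamma\vdash e:A\hookrightarrow t$ (mode annotations erased). Constants (at their basic type), variables, $\lambda$ (at a well-formed $A\to A'$), application, $\mathsf{let}$ and $\mathsf{if}$ (condition of type $\mathsf{bool}$) are typed as in the simply typed $\lambda$-calculus and elaborated homomorphically. Moreover: if $v$ is a value, $\Gamma\vdash v:A_k\hookrightarrow t_k$ for $k=1,2$ and $A_1\wedge A_2$ is well formed, then $\Gamma\vdash v:A_1\wedge A_2\hookrightarrow\langle t_1,t_2\rangle$; if $\Gamma\vdash e:A_1\wedge A_2\hookrightarrow t$ then $\Gamma\vdash e:A_k\hookrightarrow\mathsf{proj}_k t$; if $\Gamma\vdash e:A_k\hookrightarrow t$ and $A_1\vee A_2$ is well formed, then $\Gamma\vdash e:A_1\vee A_2\hookrightarrow\mathsf{inj}_k t$; if $\Gamma\vdash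 e_0:A_1\vee A_2\hookrightarrow t_0$ and $\Gamma,x_k:A_k\vdash E[x_k]:A\hookrightarrow t_k$ ($k=1,2$, $x_k$ not free in $E$), then $\Gamma\vdash E[e_0]:A\hookrightarrow\mathsf{case}\ t_0\ \mathsf{of}\ x_1.t_1\mid x_2.t_2$; if $\Gamma\vdash e:A\hookrightarrow t$ and $\mathrm{tag}(A)\cap\mathrm{tag}(A')=\emptyset$, then $\Gamma\vdash e:A'\hookrightarrow\mathrm{DEAD}_{A\downarrow A'}(t)$. *Refinement types* are $R ::= \{\nu:B\mid p\}\mid (x:R)\to R'\mid R+R'\mid R\times R'$, predicates $p$ being target expressions; a closed predicate holds if it evaluates to $\mathsf{true}$. Environments $\Gamma$ are sequences of bindings $x:R$ and guard predicates. Subtyping $\Gamma\vdash R<:R'$ is contravariant/covariant on functions (the codomains are compared under the smaller domain), covariant on sums and products, and $\Gamma\vdash\{\nu:B\mid p\}<:\{\nu:B\mid q\}$ iff $[\![\Gamma]\!]\Rightarrow p\Rightarrow q$ is valid: for all substitutions of closed values for the variables that make the guards of $\Gamma$ hold and send each $x:\{\nu:B'\mid p'\}$ in $\Gamma$ to a literal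 of type $B'$ satisfying $p'$, and for all literals $\nu$ of type $B$, if $p$ holds then $q$ holds. The judgment $\Gamma\vdash t::R$ is given by: subsumption; $c::(x_1:B_1)\to\dots\to(x_n:B_n)\to\{\nu:B\mid\nu=c\,x_1\cdots x_n\}$; $x::\{\nu:B\mid\nu=x\}$ if $x:\{\nu:B\mid p\}\in\Gamma$, and $x::R$ for any other binding $x:R\in\Gamma$; the usual rules for $\lambda$, $\mathsf{let}$, pairs, projections, injections and $\mathsf{case}$ (bound variables do not occur in the result type of $\mathsf{let}$, $\mathsf{case}$); $t_1\,t_2::[t_2/x]R'$ if $t_1::(x:R)\to R'$ and $t_2::R$; $\mathsf{if}\ t\ \mathsf{then}\ t_1\ \mathsf{else}\ t_2::R$ if $t::\{\nu:\mathsf{bool}\mid\mathsf{true}\}$ and $t_1::R$, $t_2::R$ under the additional guards $t$, $\neg t$ respectively; and $\mathrm{DEAD}_{A\downarrow A'}$ is treated as a function of type $\bot\langle A\rangle\to\bot\langle A'\rangle$. Here $\bot\langle A\rangle$ is $A$ with $\wedge,\vee$ replaced by $\times,+$ and each primitive type refined by $\mathsf{false}$ in positive and by $\mathsf{true}$ in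 negative positions. A source term $e$ is *well two-typed* if there are $A,t,R$ with $\emptyset\vdash e:A\hookrightarrow t$ and $\emptyset\vdash t::R$. **Theorem (Two-Phase Soundness / Safety).** 1. If $e$ is well two-typed, then $e$ is a value or there is a well two-typed $e'$ with $e\longrightarrow e'$. 2. More precisely, if $\emptyset\vdash e:A\hookrightarrow t$ and $\emptyset\vdash t::R$, then $e$ is a value or there are $e',t'$ with $e\longrightarrow e'$, $\emptyset\vdash e':A\hookrightarrow t'$, $t\longrightarrow^{+}t'$ and $\emptyset\vdash t'::R$. 3. No cast is typable in the empty environment: $\emptyset\vdash\mathrm{DEAD}_{A\downarrow A'}(t)::R$ holds for no $A,A',t,R$. 4. Well two-typed terms never get stuck: if $e$ is well two-typed and $e\longrightarrow^{*}e'$, then $e'$ is a value or $e'\longrightarrow e''$ for some $e''$. -/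

import Mathlib

namespace TwoPhase

/-! ### Primitive types and primitive constants -/

/-- Primitive types. -/
inductive Prim where
  | number
  | bool

/-- The values of a primitive type. -/
def Prim.Carrier : Prim → Type
  | .number => ℤ
  | .bool => Bool

/-- `Fn [A₁, …, Aₙ] B` is the type of (curried) functions `A₁ → ⋯ → Aₙ → B`. -/
def Fn : List Prim → Prim → Type
  | [], B => B.Carrier
  | A :: As, B => A.Carrier → Fn As B

/-- Primitive constants: every total first-order operation on numbers and booleans.  With an empty
list of arguments these are the literals `0, 1, …, true, false`; otherwise they are operators
`+, -, ¬, =, …`, a partially applied operator being again a constant. -/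
structure Const where
  args : List Prim
  res : Prim
  fn : Fn args res

def Const.lit (A : Prim) (a : A.Carrier) : Const := ⟨[], A, a⟩

def Const.ofBool (b : Bool) : Const := Const.lit .bool b

def Const.not : Const := ⟨[.bool], .bool, fun b : Bool => !b⟩

/-- Equality test on a primitive type. -/
def Const.eq : Prim → Const
  | .number => ⟨[.number, .number], .bool, fun a b : ℤ => decide (a = b)⟩
  | .bool => ⟨[.bool, .bool], .bool, fun a b : Bool => decide (a = b)⟩

/-- `PrimApp c v r`: the primitive application `⟦c⟧(v)` is defined and equals `r`.  It is defined
exactly when `v` is a literal of the argument type of the operator `c`. -/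
inductive PrimApp : Const → Const → Const → Prop
  | mk (A : Prim) (As : List Prim) (B : Prim) (f : A.Carrier → Fn As B) (a : A.Carrier) :
      PrimApp ⟨A :: As, B, f⟩ (Const.lit A a) ⟨As, B, f a⟩

/-- An index in `{1, 2}`. -/
inductive Side where
  | one
  | two

def Side.pick {α : Type} : Side → α → α → α
  | .one, a, _ => a
  | .two, _, b => b

/-- Extension of a renaming of de Bruijn indices under a binder. -/
def upRen (ξ : ℕ → ℕ) : ℕ → ℕ
  | 0 => 0
  | n + 1 => ξ n + 1

/-! ### Source language (terms up to renaming of bound variables: de Bruijn indices) -/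

/-- Source types. -/
inductive Ty where
  | prim (B : Prim)
  | arr (A B : Ty)
  | and (A B : Ty)
  | or (A B : Ty)

/-- Runtime type tags. -/
inductive Tag where
  | number
  | boolean
  | function

def Ty.tags : Ty → Set Tag
  | .prim .number => {Tag.number}
  | .prim .bool => {Tag.boolean}
  | .arr _ _ => {Tag.function}
  | .and A _ => A.tags
  | .or A B => A.tags ∪ B.tags

/-- Well-formed source types. -/
def Ty.WF : Ty → Prop
  | .prim _ => True
  | .arr A B => A.WF ∧ B.WF
  | .and A B => A.WF ∧ B.WF ∧ A.tags = B.tags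
  | .or A B => A.WF ∧ B.WF ∧ A.tags ∩ B.tags = ∅

/-- Source expressions. `lam` binds index `0` in its body, `letin e₁ e₂` binds index `0` in `e₂`. -/
inductive Src where
  | const (c : Const)
  | var (n : ℕ)
  | lam (e : Src)
  | letin (e₁ e₂ : Src)
  | ite (e e₁ e₂ : Src)
  | app (e₁ e₂ : Src)

def Src.IsValue : Src → Prop
  | .const _ => True
  | .var _ => True
  | .lam _ => True
  | _ => False

def Src.rename (ξ : ℕ → ℕ) : Src → Src
  | .const c => .const c
  | .var n => .var (ξ n)
  | .lam e => .lam (e.rename (upRen ξ))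
  | .letin e₁ e₂ => .letin (e₁.rename ξ) (e₂.rename (upRen ξ))
  | .ite e e₁ e₂ => .ite (e.rename ξ) (e₁.rename ξ) (e₂.rename ξ)
  | .app e₁ e₂ => .app (e₁.rename ξ) (e₂.rename ξ)

def Src.up (σ : ℕ → Src) : ℕ → Src
  | 0 => .var 0
  | n + 1 => (σ n).rename Nat.succ

def Src.subst (σ : ℕ → Src) : Src → Src
  | .const c => .const c
  | .var n => σ n
  | .lam e => .lam (e.subst (Src.up σ))
  | .letin e₁ e₂ => .letin (e₁.subst σ) (e₂.subst (Src.up σ))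
  | .ite e e₁ e₂ => .ite (e.subst σ) (e₁.subst σ) (e₂.subst σ)
  | .app e₁ e₂ => .app (e₁.subst σ) (e₂.subst σ)

/-- `e.inst v` is `[v/x] e`, where `x` is the variable with index `0`. -/
def Src.inst (e v : Src) : Src :=
  e.subst (fun n => match n with
    | 0 => v
    | m + 1 => .var m)

theorem Src.IsValue.rename {e : Src} (h : e.IsValue) (ξ : ℕ → ℕ) : (e.rename ξ).IsValue := by
  cases e <;> simp_all [Src.IsValue, Src.rename]

/-- Source evaluation contexts. -/
inductive SrcCtx where
  | hole
  | letin (E : SrcCtx) (e : Src)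
  | ite (E : SrcCtx) (e₁ e₂ : Src)
  | appL (E : SrcCtx) (e : Src)
  | appR (v : Src) (hv : v.IsValue) (E : SrcCtx)

def SrcCtx.plug : SrcCtx → Src → Src
  | .hole, t => t
  | .letin E e, t => .letin (E.plug t) e
  | .ite E e₁ e₂, t => .ite (E.plug t) e₁ e₂
  | .appL E e, t => .app (E.plug t) e
  | .appR v _ E, t => .app v (E.plug t)

def SrcCtx.rename (ξ : ℕ → ℕ) : SrcCtx → SrcCtx
  | .hole => .hole
  | .letin E e => .letin (E.rename ξ) (e.rename (upRen ξ))
  | .ite E e₁ e₂ => .ite (E.rename ξ) (e₁.rename ξ) (e₂.rename ξ)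
  | .appL E e => .appL (E.rename ξ) (e.rename ξ)
  | .appR v hv E => .appR (v.rename ξ) (hv.rename ξ) (E.rename ξ)

/-- Small-step semantics of the source language. -/
inductive SrcStep : Src → Src → Prop
  | ctx (E : SrcCtx) {e e' : Src} : SrcStep e e' → SrcStep (E.plug e) (E.plug e')
  | prim {c d r : Const} : PrimApp c d r → SrcStep (.app (.const c) (.const d)) (.const r)
  | beta {e v : Src} : v.IsValue → SrcStep (.app (.lam e) v) (e.inst v)
  | iteTrue {e₁ e₂ : Src} : SrcStep (.ite (.const (Const.ofBool true)) e₁ e₂) e₁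
  | iteFalse {e₁ e₂ : Src} : SrcStep (.ite (.const (Const.ofBool false)) e₁ e₂) e₂
  | letin {v e : Src} : v.IsValue → SrcStep (.letin v e) (e.inst v)

/-! ### Target language -/

/-- Target expressions. `dead A B t` is the DEAD-cast of `t` from type `A` to type `B`;
`case t t₁ t₂` binds index `0` in `t₁` and in `t₂`. -/
inductive Tgt where
  | const (c : Const)
  | var (n : ℕ)
  | lam (t : Tgt)
  | letin (t₁ t₂ : Tgt)
  | ite (t t₁ t₂ : Tgt)
  | app (t₁ t₂ : Tgt)
  | pair (t₁ t₂ : Tgt)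
  | proj (k : Side) (t : Tgt)
  | inj (k : Side) (t : Tgt)
  | case (t t₁ t₂ : Tgt)
  | dead (A B : Ty) (t : Tgt)

/-- Target values. The components of a pair need not be values. -/
def Tgt.IsValue : Tgt → Prop
  | .const _ => True
  | .var _ => True
  | .lam _ => True
  | .inj _ t => t.IsValue
  | .pair _ _ => True
  | .dead _ _ t => t.IsValue
  | _ => False

def Tgt.rename (ξ : ℕ → ℕ) : Tgt → Tgt
  | .const c => .const c
  | .var n => .var (ξ n)
  | .lam t => .lam (t.rename (upRen ξ))
  | .letin t₁ t₂ => .letin (t₁.rename ξ) (t₂.rename (upRen ξ))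
  | .ite t t₁ t₂ => .ite (t.rename ξ) (t₁.rename ξ) (t₂.rename ξ)
  | .app t₁ t₂ => .app (t₁.rename ξ) (t₂.rename ξ)
  | .pair t₁ t₂ => .pair (t₁.rename ξ) (t₂.rename ξ)
  | .proj k t => .proj k (t.rename ξ)
  | .inj k t => .inj k (t.rename ξ)
  | .case t t₁ t₂ => .case (t.rename ξ) (t₁.rename (upRen ξ)) (t₂.rename (upRen ξ))
  | .dead A B t => .dead A B (t.rename ξ)

def Tgt.shift (t : Tgt) : Tgt := t.rename Nat.succ

def Tgt.up (σ : ℕ → Tgt) : ℕ → Tgt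
  | 0 => .var 0
  | n + 1 => (σ n).shift

def Tgt.subst (σ : ℕ → Tgt) : Tgt → Tgt
  | .const c => .const c
  | .var n => σ n
  | .lam t => .lam (t.subst (Tgt.up σ))
  | .letin t₁ t₂ => .letin (t₁.subst σ) (t₂.subst (Tgt.up σ))
  | .ite t t₁ t₂ => .ite (t.subst σ) (t₁.subst σ) (t₂.subst σ)
  | .app t₁ t₂ => .app (t₁.subst σ) (t₂.subst σ)
  | .pair t₁ t₂ => .pair (t₁.subst σ) (t₂.subst σ)
  | .proj k t => .proj k (t.subst σ)
  | .inj k t => .inj k (t.subst σ)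
  | .case t t₁ t₂ => .case (t.subst σ) (t₁.subst (Tgt.up σ)) (t₂.subst (Tgt.up σ))
  | .dead A B t => .dead A B (t.subst σ)

/-- The substitution sending index `0` to `t` and index `n + 1` to `σ n`. -/
def Tgt.scons (t : Tgt) (σ : ℕ → Tgt) : ℕ → Tgt
  | 0 => t
  | n + 1 => σ n

/-- `t.inst w` is `[w/x] t`, where `x` is the variable with index `0`. -/
def Tgt.inst (t w : Tgt) : Tgt := t.subst (Tgt.scons w .var)

/-- All free variables of the term have index `< n`. -/
def Tgt.Scoped : ℕ → Tgt → Prop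
  | _, .const _ => True
  | n, .var m => m < n
  | n, .lam t => t.Scoped (n + 1)
  | n, .letin t₁ t₂ => t₁.Scoped n ∧ t₂.Scoped (n + 1)
  | n, .ite t t₁ t₂ => t.Scoped n ∧ t₁.Scoped n ∧ t₂.Scoped n
  | n, .app t₁ t₂ => t₁.Scoped n ∧ t₂.Scoped n
  | n, .pair t₁ t₂ => t₁.Scoped n ∧ t₂.Scoped n
  | n, .proj _ t => t.Scoped n
  | n, .inj _ t => t.Scoped n
  | n, .case t t₁ t₂ => t.Scoped n ∧ t₁.Scoped (n + 1) ∧ t₂.Scoped (n + 1)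
  | n, .dead _ _ t => t.Scoped n

/-- Target evaluation contexts. -/
inductive TgtCtx where
  | hole
  | letin (E : TgtCtx) (t : Tgt)
  | ite (E : TgtCtx) (t₁ t₂ : Tgt)
  | appL (E : TgtCtx) (t : Tgt)
  | appR (w : Tgt) (hw : w.IsValue) (E : TgtCtx)
  | inj (k : Side) (E : TgtCtx)
  | proj (k : Side) (E : TgtCtx)
  | dead (A B : Ty) (E : TgtCtx)
  | case (E : TgtCtx) (t₁ t₂ : Tgt)

def TgtCtx.plug : TgtCtx → Tgt → Tgt
  | .hole, s => s
  | .letin E t, s => .letin (E.plug s) t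
  | .ite E t₁ t₂, s => .ite (E.plug s) t₁ t₂
  | .appL E t, s => .app (E.plug s) t
  | .appR w _ E, s => .app w (E.plug s)
  | .inj k E, s => .inj k (E.plug s)
  | .proj k E, s => .proj k (E.plug s)
  | .dead A B E, s => .dead A B (E.plug s)
  | .case E t₁ t₂, s => .case (E.plug s) t₁ t₂

/-- Small-step semantics of the target language. There is no rule that removes a DEAD-cast, and
primitive application is not defined on DEAD-casts. -/
inductive TgtStep : Tgt → Tgt → Prop
  | ctx (E : TgtCtx) {t t' : Tgt} : TgtStep t t' → TgtStep (E.plug t) (E.plug t')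
  | prim {c d r : Const} : PrimApp c d r → TgtStep (.app (.const c) (.const d)) (.const r)
  | beta {t w : Tgt} : w.IsValue → TgtStep (.app (.lam t) w) (t.inst w)
  | iteTrue {t₁ t₂ : Tgt} : TgtStep (.ite (.const (Const.ofBool true)) t₁ t₂) t₁
  | iteFalse {t₁ t₂ : Tgt} : TgtStep (.ite (.const (Const.ofBool false)) t₁ t₂) t₂
  | letin {w t : Tgt} : w.IsValue → TgtStep (.letin w t) (t.inst w)
  | proj {k : Side} {t₁ t₂ : Tgt} : TgtStep (.proj k (.pair t₁ t₂)) (k.pick t₁ t₂)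
  | case {k : Side} {w t₁ t₂ : Tgt} : w.IsValue →
      TgtStep (.case (.inj k w) t₁ t₂) ((k.pick t₁ t₂).inst w)

/-! ### Phase 1: elaboration -/

/-- The (basic) source type of a primitive constant. -/
def Const.ty (c : Const) : Ty := c.args.foldr (fun A T => .arr (.prim A) T) (.prim c.res)

/-- The elaboration judgment `Γ ⊢ e : A ↪ t`; `Γ` lists the types of the variables `0, 1, …`. -/
inductive Elaborates : List Ty → Src → Ty → Tgt → Prop
  | const {Γ : List Ty} (c : Const) : Elaborates Γ (.const c) c.ty (.const c)
  | var {Γ : List Ty} {n : ℕ} {A : Ty} : Γ[n]? = some A → Elaborates Γ (.var n) A (.var n)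
  | letin {Γ : List Ty} {e₁ e₂ : Src} {A₁ A₂ : Ty} {t₁ t₂ : Tgt} :
      Elaborates Γ e₁ A₁ t₁ → Elaborates (A₁ :: Γ) e₂ A₂ t₂ →
      Elaborates Γ (.letin e₁ e₂) A₂ (.letin t₁ t₂)
  | ite {Γ : List Ty} {e e₁ e₂ : Src} {A : Ty} {t t₁ t₂ : Tgt} :
      Elaborates Γ e (.prim .bool) t → Elaborates Γ e₁ A t₁ → Elaborates Γ e₂ A t₂ →
      Elaborates Γ (.ite e e₁ e₂) A (.ite t t₁ t₂)
  | interIntro {Γ : List Ty} {v : Src} {A₁ A₂ : Ty} {t₁ t₂ : Tgt} :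
      v.IsValue → Elaborates Γ v A₁ t₁ → Elaborates Γ v A₂ t₂ → (Ty.and A₁ A₂).WF →
      Elaborates Γ v (.and A₁ A₂) (.pair t₁ t₂)
  | interElim {Γ : List Ty} {e : Src} {A₁ A₂ : Ty} {t : Tgt} (k : Side) :
      Elaborates Γ e (.and A₁ A₂) t → Elaborates Γ e (k.pick A₁ A₂) (.proj k t)
  | lam {Γ : List Ty} {e : Src} {A B : Ty} {t : Tgt} :
      (Ty.arr A B).WF → Elaborates (A :: Γ) e B t →
      Elaborates Γ (.lam e) (.arr A B) (.lam t)
  | app {Γ : List Ty} {e₁ e₂ : Src} {A B : Ty} {t₁ t₂ : Tgt} :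
      Elaborates Γ e₁ (.arr A B) t₁ → Elaborates Γ e₂ A t₂ →
      Elaborates Γ (.app e₁ e₂) B (.app t₁ t₂)
  | dead {Γ : List Ty} {e : Src} {A B : Ty} {t : Tgt} :
      Elaborates Γ e A t → A.tags ∩ B.tags = ∅ → Elaborates Γ e B (.dead A B t)
  | unionIntro {Γ : List Ty} {e : Src} {A₁ A₂ : Ty} {t : Tgt} (k : Side) :
      Elaborates Γ e (k.pick A₁ A₂) t → (Ty.or A₁ A₂).WF →
      Elaborates Γ e (.or A₁ A₂) (.inj k t)
  | unionElim {Γ : List Ty} {E : SrcCtx} {e₀ : Src} {A₁ A₂ B : Ty} {t₀ t₁ t₂ : Tgt} :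
      Elaborates Γ e₀ (.or A₁ A₂) t₀ →
      Elaborates (A₁ :: Γ) ((E.rename Nat.succ).plug (.var 0)) B t₁ →
      Elaborates (A₂ :: Γ) ((E.rename Nat.succ).plug (.var 0)) B t₂ →
      Elaborates Γ (E.plug e₀) B (.case t₀ t₁ t₂)

/-! ### Phase 2: refinement types -/

/-- Refinement types. Predicates are target expressions; in `base B p`, that is `{ν : B | p}`,
the value variable `ν` is index `0` of `p`. In `pi S T`, that is `(x : S) → T`, the variable `x` is
index `0` of `T`. -/
inductive RTy where
  | base (B : Prim) (p : Tgt)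
  | pi (S T : RTy)
  | sum (S T : RTy)
  | prod (S T : RTy)

def RTy.rename (ξ : ℕ → ℕ) : RTy → RTy
  | .base B p => .base B (p.rename (upRen ξ))
  | .pi S T => .pi (S.rename ξ) (T.rename (upRen ξ))
  | .sum S T => .sum (S.rename ξ) (T.rename ξ)
  | .prod S T => .prod (S.rename ξ) (T.rename ξ)

def RTy.shift (R : RTy) : RTy := R.rename Nat.succ

def RTy.subst (σ : ℕ → Tgt) : RTy → RTy
  | .base B p => .base B (p.subst (Tgt.up σ))
  | .pi S T => .pi (S.subst σ) (T.subst (Tgt.up σ))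
  | .sum S T => .sum (S.subst σ) (T.subst σ)
  | .prod S T => .prod (S.subst σ) (T.subst σ)

/-- `R.inst t` is `[t/x] R`, where `x` is the variable with index `0`. -/
def RTy.inst (R : RTy) (t : Tgt) : RTy := R.subst (Tgt.scons t .var)

/-- The predicates `true` and `false`. -/
def Tgt.ofBool (b : Bool) : Tgt := .const (Const.ofBool b)

/-- The predicate `s = t` at primitive type `B`. -/
def Tgt.eq (B : Prim) (s t : Tgt) : Tgt := .app (.app (.const (Const.eq B)) s) t

/-- The predicate `¬ t`. -/
def Tgt.neg (t : Tgt) : Tgt := .app (.const Const.not) t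

/-- `selfTy t [A₁, …, Aₙ] B` is `(x₁ : A₁) → ⋯ → (xₙ : Aₙ) → {ν : B | ν = t x₁ ⋯ xₙ}`. -/
def selfTy : Tgt → List Prim → Prim → RTy
  | t, [], B => .base B (Tgt.eq B (.var 0) t.shift)
  | t, A :: As, B => .pi (.base A (Tgt.ofBool true)) (selfTy (.app t.shift (.var 0)) As B)

/-- The refinement type of a primitive constant: `{ν : B | ν = c}` for a literal `c`, and
`(x₁ : A₁) → ⋯ → (xₙ : Aₙ) → {ν : B | ν = c x₁ ⋯ xₙ}` for an operator `c`. -/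
def Const.rty (c : Const) : RTy := selfTy (.const c) c.args c.res

/-- The refinement type given to a variable `n` bound to `R`. -/
def RTy.singleton (n : ℕ) : RTy → RTy
  | .base B _ => .base B (Tgt.eq B (.var 0) (.var (n + 1)))
  | R => R

/-- Elaboration of source types to (trivially refined) target types. -/
def Ty.toRTy : Ty → RTy
  | .prim B => .base B (Tgt.ofBool true)
  | .arr A B => .pi A.toRTy B.toRTy
  | .and A B => .prod A.toRTy B.toRTy
  | .or A B => .sum A.toRTy B.toRTy

/-- Put the refinement `r` on all primitive types in positive position, and its negation on those in
negative position. -/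
def RTy.fill : Bool → RTy → RTy
  | r, .base B _ => .base B (Tgt.ofBool r)
  | r, .pi S T => .pi (S.fill (!r)) (T.fill r)
  | r, .sum S T => .sum (S.fill r) (T.fill r)
  | r, .prod S T => .prod (S.fill r) (T.fill r)

def RTy.bot (R : RTy) : RTy := R.fill false

/-- Entries of a refinement environment: type bindings and guard predicates. Only bindings
introduce a variable. -/
inductive Entry where
  | bind (R : RTy)
  | guard (p : Tgt)

/-- `Lookup Γ n R`: variable `n` is bound to `R` in `Γ`. -/
inductive Lookup : List Entry → ℕ → RTy → Prop
  | here {Γ : List Entry} {R : RTy} : Lookup (.bind R :: Γ) 0 R.shift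
  | bind {Γ : List Entry} {n : ℕ} {R S : RTy} :
      Lookup Γ n R → Lookup (.bind S :: Γ) (n + 1) R.shift
  | guard {Γ : List Entry} {n : ℕ} {R : RTy} {p : Tgt} :
      Lookup Γ n R → Lookup (.guard p :: Γ) n R

/-- A closed predicate holds if it evaluates to `true`. -/
def Holds (p : Tgt) : Prop := Relation.ReflTransGen TgtStep p (Tgt.ofBool true)

/-- `Sat Γ σ`: the valuation `σ` of the variables by closed values satisfies the conjunction of the
guards and of the refinements of the binders in `Γ`. -/
def Sat : List Entry → (ℕ → Tgt) → Prop
  | [], σ => ∀ n, (σ n).IsValue ∧ (σ n).Scoped 0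
  | .guard p :: Γ, σ => Sat Γ σ ∧ Holds (p.subst σ)
  | .bind (.base B p) :: Γ, σ =>
      Sat Γ (fun n => σ (n + 1)) ∧ (∃ a : B.Carrier, σ 0 = .const (Const.lit B a)) ∧
        Holds (p.subst σ)
  | .bind _ :: Γ, σ =>
      Sat Γ (fun n => σ (n + 1)) ∧ (σ 0).IsValue ∧ (σ 0).Scoped 0

/-- Validity of the verification condition `⟦Γ⟧ ⇒ p ⇒ q`, with `ν` ranging over the values of `B`. -/
def Valid (Γ : List Entry) (B : Prim) (p q : Tgt) : Prop :=
  ∀ σ : ℕ → Tgt, Sat Γ σ → ∀ a : B.Carrier,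
    Holds (p.subst (Tgt.scons (.const (Const.lit B a)) σ)) →
    Holds (q.subst (Tgt.scons (.const (Const.lit B a)) σ))

/-- Refinement subtyping `Γ ⊢ R₁ <: R₂`. -/
inductive Subtype : List Entry → RTy → RTy → Prop
  | base {Γ : List Entry} {B : Prim} {p q : Tgt} :
      Valid Γ B p q → Subtype Γ (.base B p) (.base B q)
  | pi {Γ : List Entry} {S S' T T' : RTy} :
      Subtype Γ S' S → Subtype (.bind S' :: Γ) T T' → Subtype Γ (.pi S T) (.pi S' T')
  | sum {Γ : List Entry} {S S' T T' : RTy} :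
      Subtype Γ S S' → Subtype Γ T T' → Subtype Γ (.sum S T) (.sum S' T')
  | prod {Γ : List Entry} {S S' T T' : RTy} :
      Subtype Γ S S' → Subtype Γ T T' → Subtype Γ (.prod S T) (.prod S' T')

/-- Refinement type checking `Γ ⊢ t :: R`. A DEAD-cast from `A` to `B` is checked as a call to a
function of type `⊥⟨A⟩ → ⊥⟨B⟩`. -/
inductive Checks : List Entry → Tgt → RTy → Prop
  | sub {Γ : List Entry} {t : Tgt} {R₁ R₂ : RTy} :
      Checks Γ t R₁ → Subtype Γ R₁ R₂ → Checks Γ t R₂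
  | const {Γ : List Entry} (c : Const) : Checks Γ (.const c) c.rty
  | var {Γ : List Entry} {n : ℕ} {R : RTy} : Lookup Γ n R → Checks Γ (.var n) (R.singleton n)
  | letin {Γ : List Entry} {t₁ t₂ : Tgt} {R₁ R₂ : RTy} :
      Checks Γ t₁ R₁ → Checks (.bind R₁ :: Γ) t₂ R₂.shift → Checks Γ (.letin t₁ t₂) R₂
  | ite {Γ : List Entry} {t t₁ t₂ : Tgt} {R : RTy} :
      Checks Γ t (.base .bool (Tgt.ofBool true)) →
      Checks (.guard t :: Γ) t₁ R → Checks (.guard t.neg :: Γ) t₂ R →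
      Checks Γ (.ite t t₁ t₂) R
  | lam {Γ : List Entry} {t : Tgt} {S T : RTy} :
      Checks (.bind S :: Γ) t T → Checks Γ (.lam t) (.pi S T)
  | app {Γ : List Entry} {t₁ t₂ : Tgt} {S T : RTy} :
      Checks Γ t₁ (.pi S T) → Checks Γ t₂ S → Checks Γ (.app t₁ t₂) (T.inst t₂)
  | pair {Γ : List Entry} {t₁ t₂ : Tgt} {R₁ R₂ : RTy} :
      Checks Γ t₁ R₁ → Checks Γ t₂ R₂ → Checks Γ (.pair t₁ t₂) (.prod R₁ R₂)
  | proj {Γ : List Entry} {t : Tgt} {R₁ R₂ : RTy} (k : Side) :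
      Checks Γ t (.prod R₁ R₂) → Checks Γ (.proj k t) (k.pick R₁ R₂)
  | inj {Γ : List Entry} {t : Tgt} {R₁ R₂ : RTy} (k : Side) :
      Checks Γ t (k.pick R₁ R₂) → Checks Γ (.inj k t) (.sum R₁ R₂)
  | case {Γ : List Entry} {t t₁ t₂ : Tgt} {R₁ R₂ R : RTy} :
      Checks Γ t (.sum R₁ R₂) →
      Checks (.bind R₁ :: Γ) t₁ R.shift → Checks (.bind R₂ :: Γ) t₂ R.shift →
      Checks Γ (.case t t₁ t₂) R
  | dead {Γ : List Entry} {A B : Ty} {t : Tgt} :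
      Checks Γ t A.toRTy.bot → Checks Γ (.dead A B t) B.toRTy.bot

/-- A source term is well two-typed if it elaborates, in the empty environment, to a target term that
has a refinement type in the empty environment. -/
def WellTwoTyped (e : Src) : Prop :=
  ∃ (A : Ty) (t : Tgt) (R : RTy), Elaborates [] e A t ∧ Checks [] t R

end TwoPhase

/-!
Write `t` for an elaboration of `e` that has a refinement type `R`.  Two facts about `t` and one
about the pair `e`, `t` give the theorem.

*Evaluation of `t` terminates* (`Checks.exists_val`).  Refinement types are interpreted as sets `Val`
of closed values by a logical relation, functions being values whose calls on arguments in the domain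
terminate in the codomain, and typable terms belong to the interpretation of their types.  In this
model `⊥⟨A⟩` is empty for every `A` (`fill_inhabited_and_empty`), so that no cast is typable in the
empty environment (`not_checks_dead`).

*Type checking is preserved by evaluation of `t`* (`Checks.preservation`).  Typed substitutions
(`Checks.subst`) cover the replacement of guards, narrowing and the substitution of values.
As types depend on terms, `[t₂/x]T` has to be equivalent to `[t₂'/x]T` when `t₂` steps to `t₂'`.
This is the purpose of the relation `Sim`: replacing closed subterms of a predicate by their reducts,
even in positions where evaluation does not reach them, does not change whether the predicate holds
(`Sim.holds_iff`).  The same fact is needed for applications in the model.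

*Each step of `t` is matched by at most one step of `e`* (`Elaborates.step`), and a term that
elaborates to a value is a value (`Elaborates.isValue`).  Hence a source term that is no value takes
a step in the course of the evaluation of `t` (`Elaborates.progress`).  As the source language is
deterministic (`SrcStep.det`), all its reducts are well two-typed.
-/

namespace TwoPhase

/-! ### Substitution algebra -/

theorem upRen_comp (ξ ζ : ℕ → ℕ) : upRen (fun n => ζ (ξ n)) = fun n => upRen ζ (upRen ξ n) := by
  funext n; cases n <;> rfl

namespace Tgt

theorem up_upRen (ξ : ℕ → ℕ) (σ : ℕ → Tgt) : up (fun n => σ (ξ n)) = fun n => up σ (upRen ξ n) := by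
  funext n; cases n <;> rfl

theorem up_var : up Tgt.var = Tgt.var := by
  funext n; cases n <;> rfl

theorem up_var_comp (ξ : ℕ → ℕ) : up (fun n => .var (ξ n)) = fun n => .var (upRen ξ n) := by
  funext n; cases n <;> rfl

theorem rename_eq_subst (t : Tgt) (ξ : ℕ → ℕ) : t.rename ξ = t.subst (fun n => .var (ξ n)) := by
  induction t generalizing ξ <;> simp_all [rename, subst, up_var_comp]

theorem rename_rename (t : Tgt) (ξ ζ : ℕ → ℕ) :
    (t.rename ξ).rename ζ = t.rename (fun n => ζ (ξ n)) := by
  induction t generalizing ξ ζ <;> simp_all [rename, upRen_comp]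

theorem rename_subst (t : Tgt) (ξ : ℕ → ℕ) (σ : ℕ → Tgt) :
    (t.rename ξ).subst σ = t.subst (fun n => σ (ξ n)) := by
  induction t generalizing ξ σ <;> simp_all [rename, subst, up_upRen]

theorem shift_rename (t : Tgt) (ξ : ℕ → ℕ) : t.shift.rename (upRen ξ) = (t.rename ξ).shift := by
  simp only [shift, rename_rename]; rfl

theorem up_rename (σ : ℕ → Tgt) (ξ : ℕ → ℕ) :
    up (fun n => (σ n).rename ξ) = fun n => (up σ n).rename (upRen ξ) := by
  funext n
  cases n with
  | zero => rfl
  | succ n => exact (shift_rename _ _).symm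

theorem subst_rename (t : Tgt) (σ : ℕ → Tgt) (ξ : ℕ → ℕ) :
    (t.subst σ).rename ξ = t.subst (fun n => (σ n).rename ξ) := by
  induction t generalizing σ ξ <;> simp_all [rename, subst, up_rename]

theorem shift_subst (t : Tgt) (σ : ℕ → Tgt) : t.shift.subst σ = t.subst (fun n => σ (n + 1)) :=
  rename_subst _ _ _

theorem shift_subst_up (t : Tgt) (σ : ℕ → Tgt) : t.shift.subst (up σ) = (t.subst σ).shift := by
  rw [shift_subst]; exact (subst_rename _ _ _).symm

theorem up_subst (σ τ : ℕ → Tgt) :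
    up (fun n => (σ n).subst τ) = fun n => (up σ n).subst (up τ) := by
  funext n
  cases n with
  | zero => rfl
  | succ n => exact (shift_subst_up _ _).symm

theorem subst_subst (t : Tgt) (σ τ : ℕ → Tgt) :
    (t.subst σ).subst τ = t.subst (fun n => (σ n).subst τ) := by
  induction t generalizing σ τ <;> simp_all [subst, up_subst]

@[simp] theorem subst_var (t : Tgt) : t.subst .var = t := by
  induction t <;> simp_all [subst, up_var]

theorem up_subst_scons (σ τ : ℕ → Tgt) (t : Tgt) :
    (fun n => (up σ n).subst (scons t τ)) = scons t (fun n => (σ n).subst τ) := by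
  funext n
  cases n with
  | zero => rfl
  | succ n => exact shift_subst _ _

theorem scons_subst (t : Tgt) (σ τ : ℕ → Tgt) :
    (fun n => (scons t σ n).subst τ) = scons (t.subst τ) (fun n => (σ n).subst τ) := by
  funext n; cases n <;> rfl

theorem scons_eta (σ : ℕ → Tgt) : scons (σ 0) (fun n => σ (n + 1)) = σ := by
  funext n; cases n <;> rfl

theorem up_inst (t u : Tgt) (σ : ℕ → Tgt) : (t.subst (up σ)).inst u = t.subst (scons u σ) := by
  rw [inst, subst_subst, up_subst_scons]; simp

theorem scoped_subst_eq {t : Tgt} {n : ℕ} (h : t.Scoped n) {σ : ℕ → Tgt}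
    (hσ : ∀ m < n, σ m = .var m) : t.subst σ = t := by
  have key : ∀ {n : ℕ} {σ : ℕ → Tgt}, (∀ m < n, σ m = .var m) → ∀ m < n + 1, up σ m = .var m := by
    intro n σ hσ m hm
    cases m with
    | zero => rfl
    | succ m => simp [up, hσ m (by omega), shift, rename]
  induction t generalizing n σ <;> simp_all [Scoped, subst] <;> grind

/-- Closed terms are invariant under substitution. -/
theorem closed_subst {t : Tgt} (h : t.Scoped 0) (σ : ℕ → Tgt) : t.subst σ = t :=
  scoped_subst_eq h (by simp)

theorem closed_rename {t : Tgt} (h : t.Scoped 0) (ξ : ℕ → ℕ) : t.rename ξ = t := by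
  rw [rename_eq_subst, closed_subst h]

theorem Scoped.rename {t : Tgt} {n m : ℕ} {ξ : ℕ → ℕ} (h : t.Scoped n)
    (hξ : ∀ k < n, ξ k < m) : (t.rename ξ).Scoped m := by
  have key : ∀ {n m : ℕ} {ξ : ℕ → ℕ}, (∀ k < n, ξ k < m) → ∀ k < n + 1, upRen ξ k < m + 1 := by
    intro n m ξ hξ k hk
    cases k with
    | zero => simp [upRen]
    | succ k => simp [upRen, hξ k (by omega)]
  induction t generalizing n m ξ <;> simp_all [Scoped, Tgt.rename] <;> grind

theorem Scoped.subst {t : Tgt} {n m : ℕ} {σ : ℕ → Tgt} (h : t.Scoped n)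
    (hσ : ∀ k < n, (σ k).Scoped m) : (t.subst σ).Scoped m := by
  have key : ∀ {n m : ℕ} {σ : ℕ → Tgt}, (∀ k < n, (σ k).Scoped m) →
      ∀ k < n + 1, (up σ k).Scoped (m + 1) := by
    intro n m σ hσ k hk
    cases k with
    | zero => simp [up, Scoped]
    | succ k => exact (hσ k (by omega)).rename (by simp)
  induction t generalizing n m σ <;> simp_all [Scoped, Tgt.subst] <;> grind

theorem subst_scoped (t : Tgt) {m : ℕ} {σ : ℕ → Tgt} (hσ : ∀ k, (σ k).Scoped m) :
    (t.subst σ).Scoped m := by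
  have key : ∀ {m : ℕ} {σ : ℕ → Tgt}, (∀ k, (σ k).Scoped m) → ∀ k, (up σ k).Scoped (m + 1) := by
    intro m σ hσ k
    cases k with
    | zero => simp [up, Scoped]
    | succ k => exact (hσ k).rename (by simp)
  induction t generalizing m σ <;> simp_all [Scoped, Tgt.subst]

end Tgt

namespace RTy

theorem rename_eq_subst (R : RTy) (ξ : ℕ → ℕ) : R.rename ξ = R.subst (fun n => .var (ξ n)) := by
  induction R generalizing ξ <;>
    simp_all [rename, subst, Tgt.up_var_comp, Tgt.rename_eq_subst]

theorem subst_subst (R : RTy) (σ τ : ℕ → Tgt) :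
    (R.subst σ).subst τ = R.subst (fun n => (σ n).subst τ) := by
  induction R generalizing σ τ <;> simp_all [subst, Tgt.up_subst, Tgt.subst_subst]

@[simp] theorem subst_var (R : RTy) : R.subst .var = R := by
  induction R <;> simp_all [subst, Tgt.up_var]

theorem shift_subst (R : RTy) (σ : ℕ → Tgt) : R.shift.subst σ = R.subst (fun n => σ (n + 1)) := by
  rw [shift, rename_eq_subst, subst_subst]; rfl

theorem shift_inst (R : RTy) (t : Tgt) : R.shift.inst t = R := by
  rw [inst, shift_subst]; exact subst_var R

theorem shift_subst_up (R : RTy) (σ : ℕ → Tgt) : R.shift.subst (Tgt.up σ) = (R.subst σ).shift := by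
  rw [shift_subst, shift, rename_eq_subst, subst_subst]
  congr 1; funext n; exact Tgt.rename_eq_subst _ _

theorem shift_rename_upRen (R : RTy) (ξ : ℕ → ℕ) :
    R.shift.rename (upRen ξ) = (R.rename ξ).shift := by
  rw [rename_eq_subst, rename_eq_subst R, ← shift_subst_up, Tgt.up_var_comp]

theorem inst_subst (R : RTy) (t : Tgt) (σ : ℕ → Tgt) :
    (R.inst t).subst σ = (R.subst (Tgt.up σ)).inst (t.subst σ) := by
  rw [inst, inst, subst_subst, subst_subst, Tgt.scons_subst, Tgt.up_subst_scons]
  congr 2; funext n; simp [Tgt.subst]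

theorem inst_rename (R : RTy) (t : Tgt) (ξ : ℕ → ℕ) :
    (R.inst t).rename ξ = (R.rename (upRen ξ)).inst (t.rename ξ) := by
  rw [rename_eq_subst, inst_subst, rename_eq_subst R, Tgt.rename_eq_subst, Tgt.up_var_comp]

theorem shift_singleton_succ (R : RTy) (n : ℕ) :
    R.shift.singleton (n + 1) = (R.singleton n).shift := by
  cases R <;> rfl

theorem singleton_rename (R : RTy) (n : ℕ) (ξ : ℕ → ℕ) :
    (R.singleton n).rename ξ = (R.rename ξ).singleton (ξ n) := by
  cases R <;> rfl

theorem shift_singleton_zero_subst (R : RTy) (σ : ℕ → Tgt) :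
    (R.shift.singleton 0).subst (Tgt.up σ) = (R.subst σ).shift.singleton 0 := by
  cases R with
  | base B p => rfl
  | _ => exact shift_subst_up _ _

end RTy

theorem RTy.rename_id (R : RTy) : R.rename (fun n => n) = R := by
  rw [RTy.rename_eq_subst]; exact R.subst_var

theorem Tgt.rename_id (t : Tgt) : t.rename (fun n => n) = t := by
  rw [Tgt.rename_eq_subst]; exact t.subst_var

theorem selfTy_subst (t : Tgt) (As : List Prim) (B : Prim) (σ : ℕ → Tgt) :
    (selfTy t As B).subst σ = selfTy (t.subst σ) As B := by
  induction As generalizing t σ with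
  | nil => simp [selfTy, RTy.subst, Tgt.eq, Tgt.subst, Tgt.shift_subst_up, Tgt.up]
  | cons A As ih =>
    simp [selfTy, RTy.subst, ih, Tgt.ofBool, Tgt.subst, Tgt.shift_subst_up, Tgt.up]

theorem Const.rty_subst (c : Const) (σ : ℕ → Tgt) : c.rty.subst σ = c.rty := selfTy_subst _ _ _ _

theorem Ty.toRTy_fill_subst (A : Ty) (r : Bool) (σ : ℕ → Tgt) :
    (A.toRTy.fill r).subst σ = A.toRTy.fill r := by
  induction A generalizing r σ <;> cases r <;>
    simp_all [Ty.toRTy, RTy.fill, RTy.subst, Tgt.ofBool, Tgt.subst]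

namespace Src

theorem up_upRen (ξ : ℕ → ℕ) (σ : ℕ → Src) : up (fun n => σ (ξ n)) = fun n => up σ (upRen ξ n) := by
  funext n; cases n <;> rfl

theorem up_var : up Src.var = Src.var := by
  funext n; cases n <;> rfl

theorem rename_rename (e : Src) (ξ ζ : ℕ → ℕ) :
    (e.rename ξ).rename ζ = e.rename (fun n => ζ (ξ n)) := by
  induction e generalizing ξ ζ <;> simp_all [rename, upRen_comp]

theorem shift_rename (e : Src) (ξ : ℕ → ℕ) :
    (e.rename Nat.succ).rename (upRen ξ) = (e.rename ξ).rename Nat.succ := by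
  simp only [rename_rename]; rfl

theorem rename_subst (e : Src) (ξ : ℕ → ℕ) (σ : ℕ → Src) :
    (e.rename ξ).subst σ = e.subst (fun n => σ (ξ n)) := by
  induction e generalizing ξ σ <;> simp_all [rename, subst, up_upRen]

theorem up_rename (σ : ℕ → Src) (ξ : ℕ → ℕ) :
    up (fun n => (σ n).rename ξ) = fun n => (up σ n).rename (upRen ξ) := by
  funext n
  cases n with
  | zero => rfl
  | succ n => exact (shift_rename _ _).symm

theorem subst_rename (e : Src) (σ : ℕ → Src) (ξ : ℕ → ℕ) :
    (e.subst σ).rename ξ = e.subst (fun n => (σ n).rename ξ) := by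
  induction e generalizing σ ξ <;> simp_all [rename, subst, up_rename]

theorem shift_subst_up (e : Src) (σ : ℕ → Src) :
    (e.rename Nat.succ).subst (up σ) = (e.subst σ).rename Nat.succ := by
  rw [rename_subst, subst_rename]; rfl

@[simp] theorem subst_var (e : Src) : e.subst .var = e := by
  induction e <;> simp_all [subst, up_var]

theorem IsValue.subst {e : Src} (h : e.IsValue) {σ : ℕ → Src} (hσ : ∀ n, (σ n).IsValue) :
    (e.subst σ).IsValue := by
  cases e <;> simp_all [IsValue, Src.subst]

theorem up_isValue {σ : ℕ → Src} (hσ : ∀ n, (σ n).IsValue) (n : ℕ) : (up σ n).IsValue := by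
  cases n with
  | zero => trivial
  | succ n => exact (hσ n).rename _

end Src

namespace SrcCtx

/-- Substitution in a source evaluation context.  Variables are values and may stand to the left of
the hole, so only values can be substituted for them. -/
def subst (σ : ℕ → Src) (hσ : ∀ n, (σ n).IsValue) : SrcCtx → SrcCtx
  | .hole => .hole
  | .letin E e => .letin (E.subst σ hσ) (e.subst (Src.up σ))
  | .ite E e₁ e₂ => .ite (E.subst σ hσ) (e₁.subst σ) (e₂.subst σ)
  | .appL E e => .appL (E.subst σ hσ) (e.subst σ)
  | .appR v hv E => .appR (v.subst σ) (hv.subst hσ) (E.subst σ hσ)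

theorem plug_rename (E : SrcCtx) (e : Src) (ξ : ℕ → ℕ) :
    (E.plug e).rename ξ = (E.rename ξ).plug (e.rename ξ) := by
  induction E <;> simp_all [plug, rename, Src.rename]

theorem plug_subst (E : SrcCtx) (e : Src) {σ : ℕ → Src} (hσ : ∀ n, (σ n).IsValue) :
    (E.plug e).subst σ = (E.subst σ hσ).plug (e.subst σ) := by
  induction E <;> simp_all [plug, subst, Src.subst]

theorem shift_rename (E : SrcCtx) (ξ : ℕ → ℕ) :
    (E.rename Nat.succ).rename (upRen ξ) = (E.rename ξ).rename Nat.succ := by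
  induction E <;> simp_all [rename, Src.shift_rename]
  · simp only [Src.rename_rename]; congr 1; funext n; cases n <;> rfl

theorem shift_subst_up (E : SrcCtx) {σ : ℕ → Src} (hσ : ∀ n, (σ n).IsValue) :
    (E.rename Nat.succ).subst (Src.up σ) (Src.up_isValue hσ) = (E.subst σ hσ).rename Nat.succ := by
  induction E <;> simp_all [rename, subst, Src.shift_subst_up]
  · rw [Src.rename_subst, Src.subst_rename]
    congr 1; funext n
    cases n with
    | zero => rfl
    | succ n => exact (Src.shift_rename _ _).symm

theorem plug_shift_inst (E : SrcCtx) (v : Src) :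
    ((E.rename Nat.succ).plug (.var 0)).inst v = E.plug v := by
  have key : ∀ e : Src, (e.rename Nat.succ).inst v = e := fun e => by
    rw [Src.inst, Src.rename_subst]; exact e.subst_var
  induction E <;> simp_all [plug, rename, Src.inst, Src.subst]
  · rw [Src.rename_subst]
    convert Src.subst_var _ using 2
    funext n; cases n <;> rfl

end SrcCtx

/-! ### Evaluation of target terms -/

open Relation (ReflTransGen)

/-- Small-step semantics of the target language presented by one congruence rule for each
evaluation frame. -/
inductive FStep : Tgt → Tgt → Prop
  | cLetin {t t' s : Tgt} : FStep t t' → FStep (.letin t s) (.letin t' s)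
  | cIte {t t' s₁ s₂ : Tgt} : FStep t t' → FStep (.ite t s₁ s₂) (.ite t' s₁ s₂)
  | cAppL {t t' s : Tgt} : FStep t t' → FStep (.app t s) (.app t' s)
  | cAppR {w t t' : Tgt} : w.IsValue → FStep t t' → FStep (.app w t) (.app w t')
  | cInj {k : Side} {t t' : Tgt} : FStep t t' → FStep (.inj k t) (.inj k t')
  | cProj {k : Side} {t t' : Tgt} : FStep t t' → FStep (.proj k t) (.proj k t')
  | cDead {A B : Ty} {t t' : Tgt} : FStep t t' → FStep (.dead A B t) (.dead A B t')
  | cCase {t t' s₁ s₂ : Tgt} : FStep t t' → FStep (.case t s₁ s₂) (.case t' s₁ s₂)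
  | prim {c d r : Const} : PrimApp c d r → FStep (.app (.const c) (.const d)) (.const r)
  | beta {t w : Tgt} : w.IsValue → FStep (.app (.lam t) w) (t.inst w)
  | iteTrue {t₁ t₂ : Tgt} : FStep (.ite (.const (Const.ofBool true)) t₁ t₂) t₁
  | iteFalse {t₁ t₂ : Tgt} : FStep (.ite (.const (Const.ofBool false)) t₁ t₂) t₂
  | letin {w t : Tgt} : w.IsValue → FStep (.letin w t) (t.inst w)
  | proj {k : Side} {t₁ t₂ : Tgt} : FStep (.proj k (.pair t₁ t₂)) (k.pick t₁ t₂)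
  | case {k : Side} {w t₁ t₂ : Tgt} : w.IsValue →
      FStep (.case (.inj k w) t₁ t₂) ((k.pick t₁ t₂).inst w)

theorem FStep.plug (E : TgtCtx) {t t' : Tgt} (h : FStep t t') : FStep (E.plug t) (E.plug t') := by
  induction E with
  | hole => exact h
  | letin E s ih => exact .cLetin ih
  | ite E s₁ s₂ ih => exact .cIte ih
  | appL E s ih => exact .cAppL ih
  | appR w hw E ih => exact .cAppR hw ih
  | inj k E ih => exact .cInj ih
  | proj k E ih => exact .cProj ih
  | dead A B E ih => exact .cDead ih
  | case E s₁ s₂ ih => exact .cCase ih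

theorem tgtStep_eq_fStep : TgtStep = FStep := by
  funext t t'
  refine propext ⟨fun h => ?_, fun h => ?_⟩
  · induction h with
    | ctx E _ ih => exact ih.plug E
    | prim h => exact .prim h
    | beta h => exact .beta h
    | iteTrue => exact .iteTrue
    | iteFalse => exact .iteFalse
    | letin h => exact .letin h
    | proj => exact .proj
    | case h => exact .case h
  · induction h with
    | cLetin _ ih => exact .ctx (.letin .hole _) ih
    | cIte _ ih => exact .ctx (.ite .hole _ _) ih
    | cAppL _ ih => exact .ctx (.appL .hole _) ih
    | cAppR hw _ ih => exact .ctx (.appR _ hw .hole) ih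
    | cInj _ ih => exact .ctx (.inj _ .hole) ih
    | cProj _ ih => exact .ctx (.proj _ .hole) ih
    | cDead _ ih => exact .ctx (.dead _ _ .hole) ih
    | cCase _ ih => exact .ctx (.case .hole _ _) ih
    | prim h => exact .prim h
    | beta h => exact .beta h
    | iteTrue => exact .iteTrue
    | iteFalse => exact .iteFalse
    | letin h => exact .letin h
    | proj => exact .proj
    | case h => exact .case h

/-- Evaluation of target terms in any number of steps. -/
abbrev Steps : Tgt → Tgt → Prop := ReflTransGen FStep

theorem holds_iff {p : Tgt} : Holds p ↔ Steps p (Tgt.ofBool true) := by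
  rw [Holds, tgtStep_eq_fStep]

theorem Tgt.IsValue.not_fStep {w t : Tgt} (hw : w.IsValue) : ¬ FStep w t := by
  induction w generalizing t with
  | inj k w ih =>
    intro h
    cases h with
    | cInj h => exact ih hw h
  | dead A B w ih =>
    intro h
    cases h with
    | cDead h => exact ih hw h
  | const | var | lam | pair => nofun
  | _ => exact hw.elim

theorem FStep.not_isValue {t t' : Tgt} (h : FStep t t') : ¬ t.IsValue := fun ht => ht.not_fStep h

theorem Tgt.IsValue.steps_eq {w t : Tgt} (hw : w.IsValue) (h : Steps w t) : t = w := by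
  rcases h.cases_head with h | ⟨_, h, _⟩
  · exact h.symm
  · exact (hw.not_fStep h).elim

theorem PrimApp.det {c d r r' : Const} (h : PrimApp c d r) (h' : PrimApp c d r') : r = r' := by
  cases h with
  | mk A As B f a =>
    generalize hd : Const.lit A a = d at h'
    cases h' with
    | mk _ _ _ _ a' => cases hd; rfl

theorem Const.lit_injective {A : Prim} {a b : A.Carrier} (h : Const.lit A a = Const.lit A b) :
    a = b := by
  cases h; rfl

theorem Const.ofBool_injective {a b : Bool} (h : Const.ofBool a = Const.ofBool b) : a = b :=
  Const.lit_injective h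

theorem FStep.det {t s s' : Tgt} (h : FStep t s) (h' : FStep t s') : s = s' := by
  induction h generalizing s' with
  | cLetin h ih =>
    cases h' with
    | cLetin h' => rw [ih h']
    | letin hw => exact (h.not_isValue hw).elim
  | cIte h ih =>
    cases h' with
    | cIte h' => rw [ih h']
    | iteTrue | iteFalse => exact (h.not_isValue trivial).elim
  | cAppL h ih =>
    cases h' with
    | cAppL h' => rw [ih h']
    | cAppR hw _ => exact (h.not_isValue hw).elim
    | prim | beta => exact (h.not_isValue trivial).elim
  | cAppR hw h ih =>
    cases h' with
    | cAppL h' => exact (h'.not_isValue hw).elim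
    | cAppR _ h' => rw [ih h']
    | prim => exact (h.not_isValue trivial).elim
    | beta hw => exact (h.not_isValue hw).elim
  | cInj h ih => cases h' with | cInj h' => rw [ih h']
  | cProj h ih =>
    cases h' with
    | cProj h' => rw [ih h']
    | proj => exact (h.not_isValue trivial).elim
  | cDead h ih => cases h' with | cDead h' => rw [ih h']
  | cCase h ih =>
    cases h' with
    | cCase h' => rw [ih h']
    | case hw => exact (h.not_isValue hw).elim
  | prim hp =>
    cases h' with
    | cAppL h' | cAppR _ h' => exact (h'.not_isValue trivial).elim
    | prim hp' => rw [hp.det hp']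
  | beta hw =>
    cases h' with
    | cAppL h' => exact (h'.not_isValue trivial).elim
    | cAppR _ h' => exact (h'.not_isValue hw).elim
    | beta => rfl
  | iteTrue =>
    generalize hb : Const.ofBool true = b at h'
    cases h' with
    | cIte h' => exact (h'.not_isValue trivial).elim
    | iteTrue => rfl
    | iteFalse => exact absurd (Const.ofBool_injective hb) (by simp)
  | iteFalse =>
    generalize hb : Const.ofBool false = b at h'
    cases h' with
    | cIte h' => exact (h'.not_isValue trivial).elim
    | iteTrue => exact absurd (Const.ofBool_injective hb) (by simp)
    | iteFalse => rfl
  | letin hw =>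
    cases h' with
    | cLetin h' => exact (h'.not_isValue hw).elim
    | letin => rfl
  | proj =>
    cases h' with
    | cProj h' => exact (h'.not_isValue trivial).elim
    | proj => rfl
  | case hw =>
    cases h' with
    | cCase h' => exact (h'.not_isValue hw).elim
    | case => rfl

theorem Steps.congr {t t' : Tgt} (h : Steps t t') {f : Tgt → Tgt}
    (hf : ∀ {s s' : Tgt}, FStep s s' → FStep (f s) (f s')) : Steps (f t) (f t') := by
  induction h with
  | refl => exact .refl
  | tail _ h ih => exact ih.tail (hf h)

theorem Steps.letin {t t' s : Tgt} (h : Steps t t') : Steps (.letin t s) (.letin t' s) :=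
  h.congr (f := fun t => .letin t s) fun h => .cLetin h

theorem Steps.ite {t t' s₁ s₂ : Tgt} (h : Steps t t') : Steps (.ite t s₁ s₂) (.ite t' s₁ s₂) :=
  h.congr (f := fun t => .ite t s₁ s₂) fun h => .cIte h

theorem Steps.appL {t t' s : Tgt} (h : Steps t t') : Steps (.app t s) (.app t' s) :=
  h.congr (f := fun t => .app t s) fun h => .cAppL h

theorem Steps.appR {w t t' : Tgt} (hw : w.IsValue) (h : Steps t t') :
    Steps (.app w t) (.app w t') :=
  h.congr (f := fun t => .app w t) fun h => .cAppR hw h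

theorem Steps.inj {k : Side} {t t' : Tgt} (h : Steps t t') : Steps (.inj k t) (.inj k t') :=
  h.congr (f := fun t => .inj k t) fun h => .cInj h

theorem Steps.proj {k : Side} {t t' : Tgt} (h : Steps t t') : Steps (.proj k t) (.proj k t') :=
  h.congr (f := fun t => .proj k t) fun h => .cProj h

theorem Steps.dead {A B : Ty} {t t' : Tgt} (h : Steps t t') :
    Steps (.dead A B t) (.dead A B t') :=
  h.congr (f := fun t => .dead A B t) fun h => .cDead h

theorem Steps.case {t t' s₁ s₂ : Tgt} (h : Steps t t') :
    Steps (.case t s₁ s₂) (.case t' s₁ s₂) :=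
  h.congr (f := fun t => .case t s₁ s₂) fun h => .cCase h

theorem Steps.app {t t' s s' : Tgt} (h : Steps t t') (hw : t'.IsValue) (h' : Steps s s') :
    Steps (.app t s) (.app t' s') :=
  h.appL.trans (h'.appR hw)

theorem FStep.scoped {t t' : Tgt} (h : FStep t t') {n : ℕ} (ht : t.Scoped n) : t'.Scoped n := by
  have inst : ∀ {t w : Tgt}, t.Scoped (n + 1) → w.Scoped n → (t.inst w).Scoped n :=
    fun ht hw => ht.subst fun k hk => by
      cases k with
      | zero => exact hw
      | succ k => exact Nat.lt_of_succ_lt_succ hk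
  induction h with
  | beta _ | letin _ => simp_all [Tgt.Scoped]
  | @proj k => cases k <;> simp_all [Tgt.Scoped, Side.pick]
  | @case k => cases k <;> simp_all [Tgt.Scoped, Side.pick]
  | _ => simp_all [Tgt.Scoped]

theorem Steps.scoped {t t' : Tgt} (h : Steps t t') {n : ℕ} (ht : t.Scoped n) : t'.Scoped n := by
  induction h with
  | refl => exact ht
  | tail _ h ih => exact h.scoped ih

/-! ### Replacing closed subterms by their reducts -/

/-- `Sim s t`: the term `t` arises from `s` by replacing closed subterms, in arbitrary positions,
by terms to which they evaluate. -/
inductive Sim : Tgt → Tgt → Prop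
  | const (c : Const) : Sim (.const c) (.const c)
  | var (n : ℕ) : Sim (.var n) (.var n)
  | lam {s t : Tgt} : Sim s t → Sim (.lam s) (.lam t)
  | letin {s₁ s₂ t₁ t₂ : Tgt} : Sim s₁ t₁ → Sim s₂ t₂ → Sim (.letin s₁ s₂) (.letin t₁ t₂)
  | ite {s s₁ s₂ t t₁ t₂ : Tgt} :
      Sim s t → Sim s₁ t₁ → Sim s₂ t₂ → Sim (.ite s s₁ s₂) (.ite t t₁ t₂)
  | app {s₁ s₂ t₁ t₂ : Tgt} : Sim s₁ t₁ → Sim s₂ t₂ → Sim (.app s₁ s₂) (.app t₁ t₂)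
  | pair {s₁ s₂ t₁ t₂ : Tgt} : Sim s₁ t₁ → Sim s₂ t₂ → Sim (.pair s₁ s₂) (.pair t₁ t₂)
  | proj {k : Side} {s t : Tgt} : Sim s t → Sim (.proj k s) (.proj k t)
  | inj {k : Side} {s t : Tgt} : Sim s t → Sim (.inj k s) (.inj k t)
  | case {s s₁ s₂ t t₁ t₂ : Tgt} :
      Sim s t → Sim s₁ t₁ → Sim s₂ t₂ → Sim (.case s s₁ s₂) (.case t t₁ t₂)
  | dead {A B : Ty} {s t : Tgt} : Sim s t → Sim (.dead A B s) (.dead A B t)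
  | steps {a b : Tgt} : a.Scoped 0 → Steps a b → Sim a b

namespace Sim

theorem refl (t : Tgt) : Sim t t := by
  induction t <;> constructor <;> assumption

theorem rename {s t : Tgt} (h : Sim s t) (ξ : ℕ → ℕ) : Sim (s.rename ξ) (t.rename ξ) := by
  induction h generalizing ξ with
  | steps ha h =>
    rw [Tgt.closed_rename ha, Tgt.closed_rename (h.scoped ha)]
    exact .steps ha h
  | _ => constructor <;> solve_by_elim

theorem up {σ τ : ℕ → Tgt} (h : ∀ n, Sim (σ n) (τ n)) (n : ℕ) : Sim (Tgt.up σ n) (Tgt.up τ n) := by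
  cases n with
  | zero => exact .var 0
  | succ n => exact (h n).rename _

theorem scons {σ τ : ℕ → Tgt} {s t : Tgt} (h₀ : Sim s t) (h : ∀ n, Sim (σ n) (τ n)) (n : ℕ) :
    Sim (Tgt.scons s σ n) (Tgt.scons t τ n) := by
  cases n with
  | zero => exact h₀
  | succ n => exact h n

theorem subst {s t : Tgt} (h : Sim s t) {σ τ : ℕ → Tgt} (hσ : ∀ n, Sim (σ n) (τ n)) :
    Sim (s.subst σ) (t.subst τ) := by
  induction h generalizing σ τ with
  | steps ha h =>
    rw [Tgt.closed_subst ha, Tgt.closed_subst (h.scoped ha)]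
    exact .steps ha h
  | var n => exact hσ n
  | lam _ ih => exact .lam (ih (up hσ))
  | letin _ _ ih₁ ih₂ => exact .letin (ih₁ hσ) (ih₂ (up hσ))
  | case _ _ _ ih ih₁ ih₂ => exact .case (ih hσ) (ih₁ (up hσ)) (ih₂ (up hσ))
  | _ => constructor <;> solve_by_elim

theorem inst {s t v w : Tgt} (h : Sim s t) (h' : Sim v w) : Sim (s.inst v) (t.inst w) :=
  h.subst (scons h' .var)

theorem pick {s₁ s₂ t₁ t₂ : Tgt} (h₁ : Sim s₁ t₁) (h₂ : Sim s₂ t₂) (k : Side) :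
    Sim (k.pick s₁ s₂) (k.pick t₁ t₂) := by
  cases k
  · exact h₁
  · exact h₂

theorem isValue {s t : Tgt} (h : Sim s t) (hs : s.IsValue) : t.IsValue := by
  induction h with
  | steps _ h => rwa [hs.steps_eq h]
  | _ => simp_all [Tgt.IsValue]

theorem exists_value {s t : Tgt} (h : Sim s t) (ht : t.IsValue) :
    ∃ w, Steps s w ∧ w.IsValue ∧ Sim w t := by
  induction h with
  | steps _ h => exact ⟨_, h, ht, refl _⟩
  | const c => exact ⟨_, .refl, ht, .const c⟩
  | var n => exact ⟨_, .refl, ht, .var n⟩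
  | lam h => exact ⟨_, .refl, trivial, .lam h⟩
  | pair h₁ h₂ => exact ⟨_, .refl, trivial, .pair h₁ h₂⟩
  | inj _ ih =>
    obtain ⟨w, h₁, h₂, h₃⟩ := ih ht
    exact ⟨_, h₁.inj, h₂, h₃.inj⟩
  | dead _ ih =>
    obtain ⟨w, h₁, h₂, h₃⟩ := ih ht
    exact ⟨_, h₁.dead, h₂, h₃.dead⟩
  | _ => exact ht.elim

/-! Values are related only to values of the same form, with related components. -/

theorem const_left {c : Const} {t : Tgt} (h : Sim (.const c) t) : t = .const c := by
  cases h with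
  | steps _ h => exact Tgt.IsValue.steps_eq trivial h
  | const => rfl

theorem lam_left {s t : Tgt} (h : Sim (.lam s) t) : ∃ t', t = .lam t' ∧ Sim s t' := by
  cases h with
  | steps _ h => exact ⟨s, Tgt.IsValue.steps_eq trivial h, refl _⟩
  | lam h => exact ⟨_, rfl, h⟩

theorem pair_left {s₁ s₂ t : Tgt} (h : Sim (.pair s₁ s₂) t) :
    ∃ t₁ t₂, t = .pair t₁ t₂ ∧ Sim s₁ t₁ ∧ Sim s₂ t₂ := by
  cases h with
  | steps _ h => exact ⟨s₁, s₂, Tgt.IsValue.steps_eq trivial h, refl _, refl _⟩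
  | pair h₁ h₂ => exact ⟨_, _, rfl, h₁, h₂⟩

theorem inj_left {k : Side} {s t : Tgt} (hs : s.IsValue) (h : Sim (.inj k s) t) :
    ∃ t', t = .inj k t' ∧ Sim s t' := by
  cases h with
  | steps _ h => exact ⟨s, Tgt.IsValue.steps_eq (w := .inj k s) hs h, refl _⟩
  | inj h => exact ⟨_, rfl, h⟩

theorem const_right {c : Const} {s : Tgt} (hs : s.IsValue) (h : Sim s (.const c)) :
    s = .const c := by
  cases h with
  | steps _ h => exact (hs.steps_eq h).symm
  | const => rfl

theorem lam_right {s t : Tgt} (hs : s.IsValue) (h : Sim s (.lam t)) :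
    ∃ s', s = .lam s' ∧ Sim s' t := by
  cases h with
  | steps _ h => exact ⟨t, (hs.steps_eq h).symm, refl _⟩
  | lam h => exact ⟨_, rfl, h⟩

theorem pair_right {s t₁ t₂ : Tgt} (hs : s.IsValue) (h : Sim s (.pair t₁ t₂)) :
    ∃ s₁ s₂, s = .pair s₁ s₂ ∧ Sim s₁ t₁ ∧ Sim s₂ t₂ := by
  cases h with
  | steps _ h => exact ⟨t₁, t₂, (hs.steps_eq h).symm, refl _, refl _⟩
  | pair h₁ h₂ => exact ⟨_, _, rfl, h₁, h₂⟩

theorem inj_right {k : Side} {s t : Tgt} (hs : s.IsValue) (h : Sim s (.inj k t)) :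
    ∃ s', s = .inj k s' ∧ Sim s' t := by
  cases h with
  | steps _ h => exact ⟨t, (hs.steps_eq h).symm, refl _⟩
  | inj h => exact ⟨_, rfl, h⟩

/-- The right-hand term follows each step of the left-hand one, possibly by standing still: a closed
subterm may already have been replaced by the result of the step. -/
theorem fStep {s s' t : Tgt} (h : Sim s t) (hs : FStep s s') : ∃ t', Steps t t' ∧ Sim s' t' := by
  -- a closed term that steps and evaluates to `b` does so through its unique reduct
  have base : ∀ {a a' b : Tgt}, a.Scoped 0 → Steps a b → FStep a a' →
      ∃ t', Steps b t' ∧ Sim a' t' := by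
    intro a a' b ha hab haa'
    rcases hab.cases_head with rfl | ⟨a'', h₁, h₂⟩
    · exact ⟨a', .single haa', refl _⟩
    · obtain rfl := h₁.det haa'
      exact ⟨b, .refl, .steps (h₁.scoped ha) h₂⟩
  induction hs generalizing t with
  | cLetin hs ih =>
    cases h with
    | steps ha h => exact base ha h (.cLetin hs)
    | letin h₁ h₂ => obtain ⟨t', h₃, h₄⟩ := ih h₁; exact ⟨_, h₃.letin, .letin h₄ h₂⟩
  | cIte hs ih =>
    cases h with
    | steps ha h => exact base ha h (.cIte hs)
    | ite h h₁ h₂ => obtain ⟨t', h₃, h₄⟩ := ih h; exact ⟨_, h₃.ite, .ite h₄ h₁ h₂⟩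
  | cAppL hs ih =>
    cases h with
    | steps ha h => exact base ha h (.cAppL hs)
    | app h₁ h₂ => obtain ⟨t', h₃, h₄⟩ := ih h₁; exact ⟨_, h₃.appL, .app h₄ h₂⟩
  | cAppR hw hs ih =>
    cases h with
    | steps ha h => exact base ha h (.cAppR hw hs)
    | app h₁ h₂ =>
      obtain ⟨t', h₃, h₄⟩ := ih h₂
      exact ⟨_, h₃.appR (h₁.isValue hw), .app h₁ h₄⟩
  | cInj hs ih =>
    cases h with
    | steps ha h => exact base ha h (.cInj hs)
    | inj h => obtain ⟨t', h₃, h₄⟩ := ih h; exact ⟨_, h₃.inj, .inj h₄⟩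
  | cProj hs ih =>
    cases h with
    | steps ha h => exact base ha h (.cProj hs)
    | proj h => obtain ⟨t', h₃, h₄⟩ := ih h; exact ⟨_, h₃.proj, .proj h₄⟩
  | cDead hs ih =>
    cases h with
    | steps ha h => exact base ha h (.cDead hs)
    | dead h => obtain ⟨t', h₃, h₄⟩ := ih h; exact ⟨_, h₃.dead, .dead h₄⟩
  | cCase hs ih =>
    cases h with
    | steps ha h => exact base ha h (.cCase hs)
    | case h h₁ h₂ => obtain ⟨t', h₃, h₄⟩ := ih h; exact ⟨_, h₃.case, .case h₄ h₁ h₂⟩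
  | prim hp =>
    cases h with
    | steps ha h => exact base ha h (.prim hp)
    | app h₁ h₂ =>
      obtain rfl := h₁.const_left
      obtain rfl := h₂.const_left
      exact ⟨_, .single (.prim hp), .const _⟩
  | beta hw =>
    cases h with
    | steps ha h => exact base ha h (.beta hw)
    | app h₁ h₂ =>
      obtain ⟨t', rfl, h₃⟩ := h₁.lam_left
      exact ⟨_, .single (.beta (h₂.isValue hw)), h₃.inst h₂⟩
  | iteTrue =>
    cases h with
    | steps ha h => exact base ha h .iteTrue
    | ite h h₁ h₂ => obtain rfl := h.const_left; exact ⟨_, .single .iteTrue, h₁⟩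
  | iteFalse =>
    cases h with
    | steps ha h => exact base ha h .iteFalse
    | ite h h₁ h₂ => obtain rfl := h.const_left; exact ⟨_, .single .iteFalse, h₂⟩
  | letin hw =>
    cases h with
    | steps ha h => exact base ha h (.letin hw)
    | letin h₁ h₂ => exact ⟨_, .single (.letin (h₁.isValue hw)), h₂.inst h₁⟩
  | proj =>
    cases h with
    | steps ha h => exact base ha h .proj
    | proj h =>
      obtain ⟨t₁, t₂, rfl, h₁, h₂⟩ := h.pair_left
      exact ⟨_, .single .proj, h₁.pick h₂ _⟩
  | case hw =>
    cases h with
    | steps ha h => exact base ha h (.case hw)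
    | case h h₁ h₂ =>
      obtain ⟨t', rfl, h₃⟩ := h.inj_left hw
      exact ⟨_, .single (.case (h₃.isValue hw)), (h₁.pick h₂ _).inst h₃⟩

/-- The left-hand term follows each step of the right-hand one, after evaluating those of its closed
subterms that have been replaced and whose values the step needs. -/
theorem fStep_right {s t t' : Tgt} (h : Sim s t) (ht : FStep t t') :
    ∃ s', Steps s s' ∧ Sim s' t' := by
  induction ht generalizing s with
  | cLetin ht ih =>
    cases h with
    | steps ha h => exact ⟨_, h.tail (.cLetin ht), refl _⟩
    | letin h₁ h₂ => obtain ⟨s', h₃, h₄⟩ := ih h₁; exact ⟨_, h₃.letin, .letin h₄ h₂⟩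
  | cIte ht ih =>
    cases h with
    | steps ha h => exact ⟨_, h.tail (.cIte ht), refl _⟩
    | ite h h₁ h₂ => obtain ⟨s', h₃, h₄⟩ := ih h; exact ⟨_, h₃.ite, .ite h₄ h₁ h₂⟩
  | cAppL ht ih =>
    cases h with
    | steps ha h => exact ⟨_, h.tail (.cAppL ht), refl _⟩
    | app h₁ h₂ => obtain ⟨s', h₃, h₄⟩ := ih h₁; exact ⟨_, h₃.appL, .app h₄ h₂⟩
  | cAppR hw ht ih =>
    cases h with
    | steps ha h => exact ⟨_, h.tail (.cAppR hw ht), refl _⟩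
    | app h₁ h₂ =>
      obtain ⟨v, h₅, hv, h₆⟩ := h₁.exists_value hw
      obtain ⟨s', h₃, h₄⟩ := ih h₂
      exact ⟨_, h₅.app hv h₃, .app h₆ h₄⟩
  | cInj ht ih =>
    cases h with
    | steps ha h => exact ⟨_, h.tail (.cInj ht), refl _⟩
    | inj h => obtain ⟨s', h₃, h₄⟩ := ih h; exact ⟨_, h₃.inj, .inj h₄⟩
  | cProj ht ih =>
    cases h with
    | steps ha h => exact ⟨_, h.tail (.cProj ht), refl _⟩
    | proj h => obtain ⟨s', h₃, h₄⟩ := ih h; exact ⟨_, h₃.proj, .proj h₄⟩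
  | cDead ht ih =>
    cases h with
    | steps ha h => exact ⟨_, h.tail (.cDead ht), refl _⟩
    | dead h => obtain ⟨s', h₃, h₄⟩ := ih h; exact ⟨_, h₃.dead, .dead h₄⟩
  | cCase ht ih =>
    cases h with
    | steps ha h => exact ⟨_, h.tail (.cCase ht), refl _⟩
    | case h h₁ h₂ => obtain ⟨s', h₃, h₄⟩ := ih h; exact ⟨_, h₃.case, .case h₄ h₁ h₂⟩
  | prim hp =>
    cases h with
    | steps ha h => exact ⟨_, h.tail (.prim hp), refl _⟩
    | app h₁ h₂ =>
      obtain ⟨v₁, h₃, hv₁, h₅⟩ := h₁.exists_value trivial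
      obtain ⟨v₂, h₄, hv₂, h₆⟩ := h₂.exists_value trivial
      obtain rfl := h₅.const_right hv₁
      obtain rfl := h₆.const_right hv₂
      exact ⟨_, (h₃.app hv₁ h₄).tail (.prim hp), .const _⟩
  | beta hw =>
    cases h with
    | steps ha h => exact ⟨_, h.tail (.beta hw), refl _⟩
    | app h₁ h₂ =>
      obtain ⟨v₁, h₃, hv₁, h₅⟩ := h₁.exists_value trivial
      obtain ⟨v₂, h₄, hv₂, h₆⟩ := h₂.exists_value hw
      obtain ⟨s', rfl, h₇⟩ := h₅.lam_right hv₁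
      exact ⟨_, (h₃.app hv₁ h₄).tail (.beta hv₂), h₇.inst h₆⟩
  | iteTrue =>
    cases h with
    | steps ha h => exact ⟨_, h.tail .iteTrue, refl _⟩
    | ite h h₁ h₂ =>
      obtain ⟨v, h₃, hv, h₄⟩ := h.exists_value trivial
      obtain rfl := h₄.const_right hv
      exact ⟨_, h₃.ite.tail .iteTrue, h₁⟩
  | iteFalse =>
    cases h with
    | steps ha h => exact ⟨_, h.tail .iteFalse, refl _⟩
    | ite h h₁ h₂ =>
      obtain ⟨v, h₃, hv, h₄⟩ := h.exists_value trivial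
      obtain rfl := h₄.const_right hv
      exact ⟨_, h₃.ite.tail .iteFalse, h₂⟩
  | letin hw =>
    cases h with
    | steps ha h => exact ⟨_, h.tail (.letin hw), refl _⟩
    | letin h₁ h₂ =>
      obtain ⟨v, h₃, hv, h₄⟩ := h₁.exists_value hw
      exact ⟨_, h₃.letin.tail (.letin hv), h₂.inst h₄⟩
  | proj =>
    cases h with
    | steps ha h => exact ⟨_, h.tail .proj, refl _⟩
    | proj h =>
      obtain ⟨v, h₃, hv, h₄⟩ := h.exists_value trivial
      obtain ⟨s₁, s₂, rfl, h₁, h₂⟩ := h₄.pair_right hv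
      exact ⟨_, h₃.proj.tail .proj, h₁.pick h₂ _⟩
  | case hw =>
    cases h with
    | steps ha h => exact ⟨_, h.tail (.case hw), refl _⟩
    | case h h₁ h₂ =>
      obtain ⟨v, h₃, hv, h₄⟩ := h.exists_value (t := .inj _ _) hw
      obtain ⟨s', rfl, h₅⟩ := h₄.inj_right hv
      exact ⟨_, h₃.case.tail (.case hv), (h₁.pick h₂ _).inst h₅⟩

theorem steps_left {s s' t : Tgt} (h : Sim s t) (hs : Steps s s') : ∃ t', Steps t t' ∧ Sim s' t' := by
  induction hs with
  | refl => exact ⟨t, .refl, h⟩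
  | tail _ hs ih =>
    obtain ⟨t₁, h₁, h₂⟩ := ih
    obtain ⟨t₂, h₃, h₄⟩ := h₂.fStep hs
    exact ⟨t₂, h₁.trans h₃, h₄⟩

theorem steps_right {s t t' : Tgt} (h : Sim s t) (ht : Steps t t') :
    ∃ s', Steps s s' ∧ Sim s' t' := by
  induction ht with
  | refl => exact ⟨s, .refl, h⟩
  | tail _ ht ih =>
    obtain ⟨s₁, h₁, h₂⟩ := ih
    obtain ⟨s₂, h₃, h₄⟩ := h₂.fStep_right ht
    exact ⟨s₂, h₁.trans h₃, h₄⟩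

/-- Evaluating closed subterms does not change whether a predicate holds. -/
theorem holds_iff {p q : Tgt} (h : Sim p q) : Holds p ↔ Holds q := by
  rw [TwoPhase.holds_iff, TwoPhase.holds_iff]
  constructor
  · intro hp
    obtain ⟨t, h₁, h₂⟩ := h.steps_left hp
    obtain rfl := h₂.const_left
    exact h₁
  · intro hq
    obtain ⟨s, h₁, h₂⟩ := h.steps_right hq
    obtain ⟨w, h₃, hw, h₄⟩ := h₂.exists_value trivial
    obtain rfl := h₄.const_right hw
    exact h₁.trans h₃

end Sim

/-! ### A semantic model of refinement types -/

/-- The closed values of refinement type `R` under the valuation `σ` of the free variables of `R`.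
A function belongs to `(x : S) → T` if its calls on arguments in `S` terminate with results in `T`;
the components of a pair, which are evaluated only on projection, have to terminate likewise. -/
def Val : RTy → (ℕ → Tgt) → Tgt → Prop
  | .base B p, σ, w =>
      (∃ a : B.Carrier, w = .const (Const.lit B a)) ∧ Holds (p.subst (Tgt.scons w σ))
  | .pi S T, σ, w => w.IsValue ∧ w.Scoped 0 ∧
      ∀ u, Val S σ u → ∃ w', Steps (.app w u) w' ∧ Val T (Tgt.scons u σ) w'
  | .sum S T, σ, w =>
      (∃ u, w = .inj .one u ∧ Val S σ u) ∨ (∃ u, w = .inj .two u ∧ Val T σ u)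
  | .prod S T, σ, w => ∃ t₁ t₂, w = .pair t₁ t₂ ∧ w.Scoped 0 ∧
      (∃ u, Steps t₁ u ∧ Val S σ u) ∧ (∃ u, Steps t₂ u ∧ Val T σ u)

namespace Val

theorem closed_value {R : RTy} {σ : ℕ → Tgt} {w : Tgt} (h : Val R σ w) :
    w.IsValue ∧ w.Scoped 0 := by
  induction R generalizing w with
  | base B p => obtain ⟨⟨a, rfl⟩, -⟩ := h; exact ⟨trivial, trivial⟩
  | pi S T => exact ⟨h.1, h.2.1⟩
  | sum S T ihS ihT =>
    obtain ⟨u, rfl, h⟩ | ⟨u, rfl, h⟩ := h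
    · exact (ihS h : u.IsValue ∧ u.Scoped 0)
    · exact (ihT h : u.IsValue ∧ u.Scoped 0)
  | prod S T => obtain ⟨t₁, t₂, rfl, h, -⟩ := h; exact ⟨trivial, h⟩

theorem subst_iff {R : RTy} {σ τ : ℕ → Tgt} {w : Tgt} :
    Val (R.subst τ) σ w ↔ Val R (fun n => (τ n).subst σ) w := by
  induction R generalizing σ τ w with
  | base B p => simp [Val, RTy.subst, Tgt.subst_subst, Tgt.up_subst_scons]
  | _ => simp_all [Val, RTy.subst, Tgt.up_subst_scons]

theorem shift_iff {R : RTy} {σ : ℕ → Tgt} {w : Tgt} :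
    Val R.shift σ w ↔ Val R (fun n => σ (n + 1)) w := by
  rw [RTy.shift, RTy.rename_eq_subst, subst_iff]; rfl

theorem congr {R : RTy} {σ τ : ℕ → Tgt} (h : ∀ n, Sim (σ n) (τ n)) {w : Tgt} :
    Val R σ w ↔ Val R τ w := by
  induction R generalizing σ τ w with
  | base B p => simp only [Val, ((Sim.refl p).subst (Sim.scons (.refl w) h)).holds_iff]
  | pi S T ihS ihT =>
    simp only [Val, ihS h, fun u => @ihT _ _ (Sim.scons (.refl u) h)]
  | sum S T ihS ihT | prod S T ihS ihT => simp only [Val, ihS h, ihT h]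

end Val

/-- The valuation `σ` assigns closed values to all variables, those bound in `Γ` receiving values of
their refinement types, and the guards of `Γ` hold under it. -/
def Models : List Entry → (ℕ → Tgt) → Prop
  | [], σ => ∀ n, (σ n).IsValue ∧ (σ n).Scoped 0
  | .guard p :: Γ, σ => Models Γ σ ∧ Holds (p.subst σ)
  | .bind R :: Γ, σ => Models Γ (fun n => σ (n + 1)) ∧ Val R (fun n => σ (n + 1)) (σ 0)

namespace Models

theorem sat {Γ : List Entry} {σ : ℕ → Tgt} (h : Models Γ σ) : Sat Γ σ := by
  induction Γ generalizing σ with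
  | nil => exact h
  | cons E Γ ih =>
    cases E with
    | guard p => exact ⟨ih h.1, h.2⟩
    | bind R =>
      cases R with
      | base B p =>
        refine ⟨ih h.1, h.2.1, ?_⟩
        have := h.2.2
        rwa [Tgt.scons_eta] at this
      | _ => exact ⟨ih h.1, h.2.closed_value⟩

theorem scons {Γ : List Entry} {σ : ℕ → Tgt} (h : Models Γ σ) {R : RTy} {w : Tgt}
    (hw : Val R σ w) : Models (.bind R :: Γ) (Tgt.scons w σ) :=
  ⟨h, hw⟩

theorem closed {Γ : List Entry} {σ : ℕ → Tgt} (h : Models Γ σ) (n : ℕ) :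
    (σ n).Scoped 0 := by
  induction Γ generalizing σ n with
  | nil => exact (h n).2
  | cons E Γ ih =>
    cases E with
    | guard p => exact ih h.1 n
    | bind R =>
      cases n with
      | zero => exact h.2.closed_value.2
      | succ n => exact ih h.1 n

theorem lookup {Γ : List Entry} {σ : ℕ → Tgt} (h : Models Γ σ) {n : ℕ} {R : RTy}
    (hl : Lookup Γ n R) : Val R σ (σ n) := by
  induction hl generalizing σ with
  | here => exact Val.shift_iff.2 h.2
  | bind _ ih => exact Val.shift_iff.2 (ih h.1)
  | guard _ ih => exact ih h.1

end Models

theorem Subtype.val {Γ : List Entry} {R₁ R₂ : RTy} (h : Subtype Γ R₁ R₂) {σ : ℕ → Tgt}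
    (hσ : Models Γ σ) {w : Tgt} (hw : Val R₁ σ w) : Val R₂ σ w := by
  induction h generalizing σ w with
  | base hv =>
    obtain ⟨⟨a, rfl⟩, hp⟩ := hw
    exact ⟨⟨a, rfl⟩, hv σ hσ.sat a hp⟩
  | pi _ _ ihS ihT =>
    obtain ⟨h₁, h₂, h₃⟩ := hw
    refine ⟨h₁, h₂, fun u hu => ?_⟩
    obtain ⟨w', h₄, h₅⟩ := h₃ u (ihS hσ hu)
    exact ⟨w', h₄, ihT (hσ.scons hu) h₅⟩
  | sum _ _ ihS ihT =>
    obtain ⟨u, rfl, h⟩ | ⟨u, rfl, h⟩ := hw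
    · exact .inl ⟨u, rfl, ihS hσ h⟩
    · exact .inr ⟨u, rfl, ihT hσ h⟩
  | prod _ _ ihS ihT =>
    obtain ⟨t₁, t₂, rfl, h, ⟨u₁, h₁, h₁'⟩, ⟨u₂, h₂, h₂'⟩⟩ := hw
    exact ⟨t₁, t₂, rfl, h, ⟨u₁, h₁, ihS hσ h₁'⟩, ⟨u₂, h₂, ihT hσ h₂'⟩⟩

theorem holds_eq_of_steps {B : Prim} {a : B.Carrier} {t : Tgt}
    (h : Steps t (.const (Const.lit B a))) : Holds (Tgt.eq B (.const (Const.lit B a)) t) := by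
  rw [holds_iff]
  have number : ∀ (a : ℤ) (t : Tgt), Steps t (.const (Const.lit .number a)) →
      Steps (Tgt.eq .number (.const (Const.lit .number a)) t) (Tgt.ofBool true) := by
    intro a t h
    refine (Steps.app (.single (.prim (.mk ..))) trivial h).tail ?_
    have := FStep.prim (PrimApp.mk .number [] .bool (fun b : ℤ => decide (a = b)) a)
    rwa [decide_eq_true rfl] at this
  have bool : ∀ (a : Bool) (t : Tgt), Steps t (.const (Const.lit .bool a)) →
      Steps (Tgt.eq .bool (.const (Const.lit .bool a)) t) (Tgt.ofBool true) := by
    intro a t h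
    refine (Steps.app (.single (.prim (.mk ..))) trivial h).tail ?_
    have := FStep.prim (PrimApp.mk .bool [] .bool (fun b : Bool => decide (a = b)) a)
    rwa [decide_eq_true rfl] at this
  cases B
  · exact number a t h
  · exact bool a t h

/-- A constant belongs to the type asserting that it equals `t`, if `t` evaluates to it. -/
theorem val_selfTy {As : List Prim} {B : Prim} {f : Fn As B} {t : Tgt} {σ : ℕ → Tgt}
    (h : Steps (t.subst σ) (.const ⟨As, B, f⟩)) : Val (selfTy t As B) σ (.const ⟨As, B, f⟩) := by
  induction As generalizing t σ with
  | nil =>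
    refine ⟨⟨f, rfl⟩, ?_⟩
    have := holds_eq_of_steps h
    rw [← show (t.shift).subst (Tgt.scons (.const (Const.lit B f)) σ) = t.subst σ from
      Tgt.shift_subst _ _] at this
    exact this
  | cons A As ih =>
    refine ⟨trivial, trivial, ?_⟩
    rintro u ⟨⟨a, rfl⟩, -⟩
    refine ⟨.const ⟨As, B, f a⟩, .single (.prim (.mk ..)), ih ?_⟩
    have : Steps (.app (t.subst σ) (.const (Const.lit A a))) (.const ⟨As, B, f a⟩) :=
      h.appL.tail (.prim (.mk ..))
    simpa [Tgt.subst, Tgt.shift_subst, Tgt.scons] using this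

theorem not_holds_false : ¬ Holds (Tgt.ofBool false) := by
  rw [holds_iff]
  intro h
  have h := Tgt.IsValue.steps_eq (w := Tgt.ofBool false) trivial h
  exact absurd (Const.ofBool_injective (Tgt.const.inj h)) (by simp)

/-- The type `⊥⟨A⟩` is empty.  A function in `⊥⟨A → B⟩` would yield an element of `⊥⟨B⟩` when called
on an element of the type in which the refinements of `⊥⟨A⟩` are negated, and that type is
inhabited. -/
theorem fill_inhabited_and_empty (A : Ty) (σ : ℕ → Tgt) :
    (∃ w, Val (A.toRTy.fill true) σ w) ∧ ∀ w, ¬ Val (A.toRTy.fill false) σ w := by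
  induction A generalizing σ with
  | prim B =>
    refine ⟨?_, fun w h => not_holds_false h.2⟩
    have ⟨a⟩ : Nonempty B.Carrier := by cases B; exacts [⟨(0 : ℤ)⟩, ⟨true⟩]
    exact ⟨.const (Const.lit B a), ⟨a, rfl⟩, holds_iff.2 .refl⟩
  | arr A B ihA ihB =>
    refine ⟨⟨.lam (.var 0), trivial, Nat.one_pos, fun u hu => ((ihA σ).2 u hu).elim⟩, ?_⟩
    rintro w ⟨-, -, h⟩
    obtain ⟨u, hu⟩ := (ihA σ).1
    obtain ⟨w', -, hw'⟩ := h u hu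
    exact (ihB _).2 w' hw'
  | and A B ihA ihB =>
    obtain ⟨u₁, h₁⟩ := (ihA σ).1
    obtain ⟨u₂, h₂⟩ := (ihB σ).1
    refine ⟨⟨.pair u₁ u₂, u₁, u₂, rfl, ⟨h₁.closed_value.2, h₂.closed_value.2⟩, ⟨u₁, .refl, h₁⟩,
      ⟨u₂, .refl, h₂⟩⟩, ?_⟩
    rintro w ⟨-, -, -, -, ⟨u, -, h⟩, -⟩
    exact (ihA σ).2 u h
  | or A B ihA ihB =>
    obtain ⟨u, h⟩ := (ihA σ).1
    refine ⟨⟨.inj .one u, .inl ⟨u, rfl, h⟩⟩, ?_⟩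
    rintro w (⟨u, -, h⟩ | ⟨u, -, h⟩)
    · exact (ihA σ).2 u h
    · exact (ihB σ).2 u h

/-- Soundness of refinement type checking with respect to the model: every instance of a
well-typed term by values satisfying the environment terminates with a value of its type. -/
theorem Checks.exists_val {Γ : List Entry} {t : Tgt} {R : RTy} (h : Checks Γ t R) {σ : ℕ → Tgt}
    (hσ : Models Γ σ) : ∃ w, Steps (t.subst σ) w ∧ Val R σ w := by
  induction h generalizing σ with
  | sub _ hs ih =>
    obtain ⟨w, h₁, h₂⟩ := ih hσ
    exact ⟨w, h₁, hs.val hσ h₂⟩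
  | const c => exact ⟨_, .refl, val_selfTy .refl⟩
  | @var Γ n R hl =>
    refine ⟨_, .refl, ?_⟩
    have hv := hσ.lookup hl
    cases R with
    | base B p =>
      obtain ⟨⟨a, ha⟩, -⟩ := hv
      refine ⟨⟨a, ha⟩, ?_⟩
      have := holds_eq_of_steps (B := B) (a := a) .refl
      simpa [Tgt.eq, Tgt.subst, Tgt.scons, ha] using this
    | _ => exact hv
  | letin _ _ ih₁ ih₂ =>
    obtain ⟨w₁, h₁, hw₁⟩ := ih₁ hσ
    obtain ⟨w₂, h₂, hw₂⟩ := ih₂ (hσ.scons hw₁)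
    rw [← Tgt.up_inst] at h₂
    exact ⟨w₂, (h₁.letin.tail (.letin hw₁.closed_value.1)).trans h₂, Val.shift_iff.1 hw₂⟩
  | @ite Γ t t₁ t₂ R _ _ _ ih ih₁ ih₂ =>
    obtain ⟨w, h, ⟨b, rfl⟩, -⟩ := ih hσ
    cases b with
    | true =>
      obtain ⟨w₁, h₁, hw₁⟩ := ih₁ ⟨hσ, holds_iff.2 h⟩
      exact ⟨w₁, (h.ite.tail .iteTrue).trans h₁, hw₁⟩
    | false =>
      have hn : Holds (t.neg.subst σ) :=
        holds_iff.2 ((h.appR (w := .const Const.not) trivial).tail <|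
          .prim (.mk .bool [] .bool (fun b : Bool => !b) false))
      obtain ⟨w₂, h₂, hw₂⟩ := ih₂ ⟨hσ, hn⟩
      exact ⟨w₂, (h.ite.tail .iteFalse).trans h₂, hw₂⟩
  | @lam Γ t S T _ ih =>
    refine ⟨_, .refl, trivial, (Tgt.lam t).subst_scoped hσ.closed, fun u hu => ?_⟩
    obtain ⟨w, h, hw⟩ := ih (hσ.scons hu)
    rw [← Tgt.up_inst] at h
    exact ⟨w, h.head (.beta hu.closed_value.1), hw⟩
  | @app Γ t₁ t₂ S T _ _ ih₁ ih₂ =>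
    obtain ⟨w₁, h₁, hw₁, -, hf⟩ := ih₁ hσ
    obtain ⟨w₂, h₂, hw₂⟩ := ih₂ hσ
    obtain ⟨w, h, hw⟩ := hf w₂ hw₂
    refine ⟨w, (h₁.app hw₁ h₂).trans h, ?_⟩
    -- `T` is instantiated with `t₂`, the model with the value of `t₂`
    rw [RTy.inst, Val.subst_iff, Tgt.scons_subst]
    exact (Val.congr (Sim.scons (.steps (t₂.subst_scoped hσ.closed) h₂) fun n => .refl _)).2 hw
  | @pair Γ t₁ t₂ R₁ R₂ _ _ ih₁ ih₂ =>
    exact ⟨_, .refl, _, _, rfl, (Tgt.pair t₁ t₂).subst_scoped hσ.closed, ih₁ hσ, ih₂ hσ⟩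
  | proj k _ ih =>
    obtain ⟨_, h, t₁, t₂, rfl, -, ⟨w₁, h₁, hw₁⟩, ⟨w₂, h₂, hw₂⟩⟩ := ih hσ
    cases k with
    | one => exact ⟨w₁, (h.proj.tail .proj).trans h₁, hw₁⟩
    | two => exact ⟨w₂, (h.proj.tail .proj).trans h₂, hw₂⟩
  | inj k _ ih =>
    obtain ⟨w, h, hw⟩ := ih hσ
    refine ⟨_, h.inj, ?_⟩
    cases k with
    | one => exact .inl ⟨w, rfl, hw⟩
    | two => exact .inr ⟨w, rfl, hw⟩
  | case _ _ _ ih ih₁ ih₂ =>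
    obtain ⟨_, h, ⟨u, rfl, hu⟩ | ⟨u, rfl, hu⟩⟩ := ih hσ
    · obtain ⟨w, h', hw⟩ := ih₁ (hσ.scons hu)
      rw [← Tgt.up_inst] at h'
      exact ⟨w, (h.case.tail (.case hu.closed_value.1)).trans h', Val.shift_iff.1 hw⟩
    · obtain ⟨w, h', hw⟩ := ih₂ (hσ.scons hu)
      rw [← Tgt.up_inst] at h'
      exact ⟨w, (h.case.tail (.case hu.closed_value.1)).trans h', Val.shift_iff.1 hw⟩
  | dead _ ih =>
    obtain ⟨w, -, hw⟩ := ih hσ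
    exact ((fill_inhabited_and_empty _ _).2 w hw).elim

/-- The empty environment has a model, as every variable may be sent to a literal. -/
theorem exists_models_nil : ∃ σ, Models [] σ :=
  ⟨fun _ => Tgt.ofBool true, fun _ => ⟨trivial, trivial⟩⟩

theorem not_checks_dead {A B : Ty} {t : Tgt} {R : RTy} : ¬ Checks [] (.dead A B t) R := by
  intro h
  generalize hs : Tgt.dead A B t = s at h
  generalize hΓ : ([] : List Entry) = Γ at h
  induction h with
  | sub _ _ ih => exact ih hs hΓ
  | dead h =>
    subst hΓ
    obtain ⟨σ, hσ⟩ := exists_models_nil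
    obtain ⟨w, -, hw⟩ := h.exists_val hσ
    exact (fill_inhabited_and_empty _ _).2 w hw
  | _ => cases hs

/-! ### Substitution in subtyping and refinement type checking -/

theorem Sat.tail {Γ : List Entry} {R : RTy} {σ : ℕ → Tgt} (h : Sat (.bind R :: Γ) σ) :
    Sat Γ (fun n => σ (n + 1)) := by
  cases R <;> exact h.1

/-- Composing the substitution `σ` with a valuation that satisfies `Δ` gives one that satisfies
`Γ`. -/
def SatMap (Δ : List Entry) (σ : ℕ → Tgt) (Γ : List Entry) : Prop :=
  ∀ τ, Sat Δ τ → Sat Γ (fun n => (σ n).subst τ)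

namespace SatMap

theorem bind {Γ Δ : List Entry} {σ : ℕ → Tgt} (h : SatMap Δ σ Γ) (R : RTy) :
    SatMap (.bind (R.subst σ) :: Δ) (Tgt.up σ) (.bind R :: Γ) := by
  have key : ∀ τ : ℕ → Tgt, (fun n => (Tgt.up σ (n + 1)).subst τ) =
      fun n => (σ n).subst fun n => τ (n + 1) := fun τ => by
    funext n; exact Tgt.shift_subst _ _
  intro τ hτ
  have h' := h _ hτ.tail
  rw [← key] at h'
  cases R with
  | base B p => exact ⟨h', hτ.2.1, by simpa [RTy.subst, Tgt.subst_subst] using hτ.2.2⟩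
  | _ => exact ⟨h', hτ.2⟩

theorem guard {Γ Δ : List Entry} {σ : ℕ → Tgt} (h : SatMap Δ σ Γ) (p : Tgt) :
    SatMap (.guard (p.subst σ) :: Δ) σ (.guard p :: Γ) :=
  fun τ hτ => ⟨h τ hτ.1, by simpa [Tgt.subst_subst] using hτ.2⟩

theorem weaken_bind (Γ : List Entry) (R : RTy) :
    SatMap (.bind R :: Γ) (fun n => .var (n + 1)) Γ :=
  fun _ hτ => hτ.tail

theorem weaken_guard (Γ : List Entry) (p : Tgt) : SatMap (.guard p :: Γ) .var Γ :=
  fun _ hτ => hτ.1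

end SatMap

theorem Subtype.subst {Γ : List Entry} {R₁ R₂ : RTy} (h : Subtype Γ R₁ R₂) {Δ : List Entry}
    {σ : ℕ → Tgt} (hσ : SatMap Δ σ Γ) : Subtype Δ (R₁.subst σ) (R₂.subst σ) := by
  induction h generalizing Δ σ with
  | base hv =>
    refine .base fun τ hτ a ha => ?_
    rw [Tgt.subst_subst, Tgt.up_subst_scons] at ha ⊢
    exact hv _ (hσ τ hτ) a ha
  | pi _ _ ihS ihT => exact .pi (ihS hσ) (ihT (hσ.bind _))
  | sum _ _ ihS ihT => exact .sum (ihS hσ) (ihT hσ)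
  | prod _ _ ihS ihT => exact .prod (ihS hσ) (ihT hσ)

theorem Subtype.refl (Γ : List Entry) (R : RTy) : Subtype Γ R R := by
  induction R generalizing Γ with
  | base B p => exact .base fun _ _ _ h => h
  | pi S T ihS ihT => exact .pi (ihS _) (ihT _)
  | sum S T ihS ihT => exact .sum (ihS _) (ihT _)
  | prod S T ihS ihT => exact .prod (ihS _) (ihT _)

/-- Narrowing of the type of the most recent variable. -/
theorem Subtype.satMap {Γ : List Entry} {S S' : RTy} (h : Subtype Γ S' S) :
    SatMap (.bind S' :: Γ) .var (.bind S :: Γ) := by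
  intro τ hτ
  change Sat _ τ
  cases h with
  | base hv =>
    obtain ⟨h₁, ⟨a, ha⟩, h₂⟩ := hτ
    refine ⟨h₁, ⟨a, ha⟩, ?_⟩
    have := hv _ h₁ a
    rw [← ha, Tgt.scons_eta] at this
    exact this h₂
  | _ => exact hτ

theorem Subtype.trans {Γ : List Entry} {R₁ R₂ R₃ : RTy} (h₁ : Subtype Γ R₁ R₂)
    (h₂ : Subtype Γ R₂ R₃) : Subtype Γ R₁ R₃ := by
  induction R₂ generalizing Γ R₁ R₃ with
  | base B p =>
    cases h₁ with
    | base hv =>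
      cases h₂ with
      | base hv' => exact .base fun τ hτ a ha => hv' τ hτ a (hv τ hτ a ha)
  | pi S T ihS ihT =>
    cases h₁ with
    | pi hS hT =>
      cases h₂ with
      | pi hS' hT' =>
        refine .pi (ihS hS' hS) (ihT ?_ hT')
        simpa using hT.subst hS'.satMap
  | sum S T ihS ihT =>
    cases h₁ with
    | sum hS hT =>
      cases h₂ with
      | sum hS' hT' => exact .sum (ihS hS hS') (ihT hT hT')
  | prod S T ihS ihT =>
    cases h₁ with
    | prod hS hT =>
      cases h₂ with
      | prod hS' hT' => exact .prod (ihS hS hS') (ihT hT hT')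

/-- Evaluating the closed terms substituted into a refinement type gives an equivalent type. -/
theorem Sim.subtype_subst (R : RTy) {σ τ : ℕ → Tgt} (h : ∀ n, Sim (σ n) (τ n)) (Γ : List Entry) :
    Subtype Γ (R.subst σ) (R.subst τ) ∧ Subtype Γ (R.subst τ) (R.subst σ) := by
  induction R generalizing Γ σ τ with
  | base B p =>
    have key : ∀ (ρ : ℕ → Tgt), Holds ((p.subst (Tgt.up σ)).subst ρ) ↔
        Holds ((p.subst (Tgt.up τ)).subst ρ) := fun ρ =>
      (((Sim.refl p).subst (Sim.up h)).subst fun n => .refl (ρ n)).holds_iff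
    exact ⟨.base fun _ _ _ => (key _).1, .base fun _ _ _ => (key _).2⟩
  | pi S T ihS ihT =>
    exact ⟨.pi (ihS h _).2 (ihT (Sim.up h) _).1, .pi (ihS h _).1 (ihT (Sim.up h) _).2⟩
  | sum S T ihS ihT => exact ⟨.sum (ihS h _).1 (ihT h _).1, .sum (ihS h _).2 (ihT h _).2⟩
  | prod S T ihS ihT => exact ⟨.prod (ihS h _).1 (ihT h _).1, .prod (ihS h _).2 (ihT h _).2⟩

theorem Checks.rename {Γ : List Entry} {t : Tgt} {R : RTy} (h : Checks Γ t R) {Δ : List Entry}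
    {ξ : ℕ → ℕ} (hl : ∀ {n : ℕ} {R : RTy}, Lookup Γ n R → Lookup Δ (ξ n) (R.rename ξ))
    (hs : SatMap Δ (fun n => .var (ξ n)) Γ) : Checks Δ (t.rename ξ) (R.rename ξ) := by
  have bind : ∀ {Γ Δ : List Entry} {ξ : ℕ → ℕ},
      (∀ {n : ℕ} {R : RTy}, Lookup Γ n R → Lookup Δ (ξ n) (R.rename ξ)) → ∀ (S : RTy) {n R},
      Lookup (.bind S :: Γ) n R →
        Lookup (.bind (S.rename ξ) :: Δ) (upRen ξ n) (R.rename (upRen ξ)) := by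
    intro Γ Δ ξ hl S n R h
    cases h with
    | here => rw [RTy.shift_rename_upRen]; exact .here
    | bind h => rw [RTy.shift_rename_upRen]; exact .bind (hl h)
  have guard : ∀ {Γ Δ : List Entry} {ξ : ℕ → ℕ},
      (∀ {n : ℕ} {R : RTy}, Lookup Γ n R → Lookup Δ (ξ n) (R.rename ξ)) → ∀ (p : Tgt) {n R},
      Lookup (.guard p :: Γ) n R → Lookup (.guard (p.rename ξ) :: Δ) (ξ n) (R.rename ξ) := by
    intro Γ Δ ξ hl p n R h
    cases h with
    | guard h => exact .guard (hl h)
  have bindSat : ∀ {Γ Δ : List Entry} {ξ : ℕ → ℕ}, SatMap Δ (fun n => .var (ξ n)) Γ →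
      ∀ S : RTy, SatMap (.bind (S.rename ξ) :: Δ) (fun n => .var (upRen ξ n)) (.bind S :: Γ) := by
    intro Γ Δ ξ hs S
    rw [RTy.rename_eq_subst, ← Tgt.up_var_comp]
    exact hs.bind S
  have guardSat : ∀ {Γ Δ : List Entry} {ξ : ℕ → ℕ}, SatMap Δ (fun n => .var (ξ n)) Γ →
      ∀ p : Tgt, SatMap (.guard (p.rename ξ) :: Δ) (fun n => .var (ξ n)) (.guard p :: Γ) := by
    intro Γ Δ ξ hs p
    rw [Tgt.rename_eq_subst]
    exact hs.guard p
  induction h generalizing Δ ξ with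
  | sub _ h ih =>
    refine .sub (ih hl hs) ?_
    simpa only [RTy.rename_eq_subst] using h.subst hs
  | const c =>
    rw [RTy.rename_eq_subst, Const.rty_subst]
    exact .const c
  | var h => rw [RTy.singleton_rename]; exact .var (hl h)
  | letin _ _ ih₁ ih₂ =>
    refine .letin (ih₁ hl hs) ?_
    rw [← RTy.shift_rename_upRen]
    exact ih₂ (bind hl _) (bindSat hs _)
  | ite _ _ _ ih ih₁ ih₂ =>
    exact .ite (ih hl hs) (ih₁ (guard hl _) (guardSat hs _))
      (ih₂ (guard hl _) (guardSat hs (Tgt.neg _)))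
  | lam _ ih => exact .lam (ih (bind hl _) (bindSat hs _))
  | app _ _ ih₁ ih₂ => rw [RTy.inst_rename]; exact .app (ih₁ hl hs) (ih₂ hl hs)
  | pair _ _ ih₁ ih₂ => exact .pair (ih₁ hl hs) (ih₂ hl hs)
  | proj k _ ih =>
    have := Checks.proj k (ih hl hs)
    cases k <;> exact this
  | inj k _ ih =>
    refine .inj k ?_
    have := ih hl hs
    cases k <;> exact this
  | case _ _ _ ih ih₁ ih₂ =>
    refine .case (ih hl hs) ?_ ?_
    · rw [← RTy.shift_rename_upRen]; exact ih₁ (bind hl _) (bindSat hs _)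
    · rw [← RTy.shift_rename_upRen]; exact ih₂ (bind hl _) (bindSat hs _)
  | dead _ ih =>
    have := ih hl hs
    simp only [RTy.rename_eq_subst, RTy.bot, Ty.toRTy_fill_subst] at this ⊢
    exact .dead this

theorem Checks.weaken_bind {Γ : List Entry} {t : Tgt} {R : RTy} (h : Checks Γ t R) (S : RTy) :
    Checks (.bind S :: Γ) t.shift R.shift :=
  h.rename .bind (.weaken_bind Γ S)

theorem Checks.weaken_guard {Γ : List Entry} {t : Tgt} {R : RTy} (h : Checks Γ t R) (p : Tgt) :
    Checks (.guard p :: Γ) t R := by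
  have := h.rename (Δ := .guard p :: Γ) (ξ := fun n => n)
    (fun h => by rw [RTy.rename_id]; exact .guard h) (.weaken_guard Γ p)
  rwa [RTy.rename_id, Tgt.rename_id] at this

/-- The substitution `σ` maps the variables of `Γ` to terms that have in `Δ` the types that the
variables have in `Γ`, and it maps valuations satisfying `Δ` to valuations satisfying `Γ`. -/
structure TypedSubst (Δ : List Entry) (σ : ℕ → Tgt) (Γ : List Entry) : Prop where
  checks : ∀ {n : ℕ} {R : RTy}, Lookup Γ n R → Checks Δ (σ n) ((R.singleton n).subst σ)
  satMap : SatMap Δ σ Γ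

namespace TypedSubst

theorem bind {Γ Δ : List Entry} {σ : ℕ → Tgt} (h : TypedSubst Δ σ Γ) (S : RTy) :
    TypedSubst (.bind (S.subst σ) :: Δ) (Tgt.up σ) (.bind S :: Γ) where
  checks hl := by
    cases hl with
    | here => rw [RTy.shift_singleton_zero_subst]; exact .var .here
    | bind hl =>
      rw [RTy.shift_singleton_succ, RTy.shift_subst_up]
      exact (h.checks hl).weaken_bind _
  satMap := h.satMap.bind S

theorem guard {Γ Δ : List Entry} {σ : ℕ → Tgt} (h : TypedSubst Δ σ Γ) (p : Tgt) :
    TypedSubst (.guard (p.subst σ) :: Δ) σ (.guard p :: Γ) where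
  checks hl := by
    cases hl with
    | guard hl => exact (h.checks hl).weaken_guard _
  satMap := h.satMap.guard p

end TypedSubst

theorem Checks.subst {Γ : List Entry} {t : Tgt} {R : RTy} (h : Checks Γ t R) {Δ : List Entry}
    {σ : ℕ → Tgt} (hσ : TypedSubst Δ σ Γ) : Checks Δ (t.subst σ) (R.subst σ) := by
  induction h generalizing Δ σ with
  | sub _ h ih => exact .sub (ih hσ) (h.subst hσ.satMap)
  | const c => rw [Const.rty_subst]; exact .const c
  | var h => exact hσ.checks h
  | letin _ _ ih₁ ih₂ =>
    refine .letin (ih₁ hσ) ?_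
    rw [← RTy.shift_subst_up]
    exact ih₂ (hσ.bind _)
  | ite _ _ _ ih ih₁ ih₂ => exact .ite (ih hσ) (ih₁ (hσ.guard _)) (ih₂ (hσ.guard (Tgt.neg _)))
  | lam _ ih => exact .lam (ih (hσ.bind _))
  | app _ _ ih₁ ih₂ => rw [RTy.inst_subst]; exact .app (ih₁ hσ) (ih₂ hσ)
  | pair _ _ ih₁ ih₂ => exact .pair (ih₁ hσ) (ih₂ hσ)
  | proj k _ ih =>
    have := Checks.proj k (ih hσ)
    cases k <;> exact this
  | inj k _ ih =>
    refine .inj k ?_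
    have := ih hσ
    cases k <;> exact this
  | case _ _ _ ih ih₁ ih₂ =>
    refine .case (ih hσ) ?_ ?_
    · rw [← RTy.shift_subst_up]; exact ih₁ (hσ.bind _)
    · rw [← RTy.shift_subst_up]; exact ih₂ (hσ.bind _)
  | dead _ ih =>
    have := ih hσ
    rw [RTy.bot, Ty.toRTy_fill_subst] at this ⊢
    exact .dead this

/-- A guard may be dropped or replaced if the valuations of the new environment satisfy the old
one. -/
theorem Checks.of_guard {t p : Tgt} {R : RTy} {Γ Δ : List Entry} (h : Checks (.guard p :: Γ) t R)
    (hl : ∀ {n : ℕ} {R : RTy}, Lookup Γ n R → Lookup Δ n R)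
    (hs : SatMap Δ .var (.guard p :: Γ)) : Checks Δ t R := by
  have := h.subst (σ := .var) ⟨fun h => ?_, hs⟩
  · simpa using this
  · cases h with
    | guard h => simpa using Checks.var (hl h)

theorem Checks.narrow {Γ : List Entry} {t : Tgt} {S S' T : RTy} (h : Checks (.bind S :: Γ) t T)
    (hS : Subtype Γ S' S) : Checks (.bind S' :: Γ) t T := by
  have := h.subst (σ := .var) ⟨fun hl => ?_, hS.satMap⟩
  · simpa using this
  rw [RTy.subst_var]
  cases hl with
  | bind hl => exact .var (.bind hl)
  | here =>
    have hv := Checks.var (Lookup.here (Γ := Γ) (R := S'))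
    have hw := hS.subst (SatMap.weaken_bind Γ S')
    have e : ∀ R : RTy, R.shift = R.subst fun n => .var (n + 1) := fun R =>
      RTy.rename_eq_subst _ _
    rw [← e, ← e] at hw
    cases hS with
    | base => exact hv
    | _ => exact .sub hv hw

/-! ### Preservation of refinement types -/

theorem Checks.scoped {Γ : List Entry} {t : Tgt} {R : RTy} (h : Checks Γ t R) {n : ℕ}
    (hn : ∀ {m : ℕ} {R : RTy}, Lookup Γ m R → m < n) : t.Scoped n := by
  have bind : ∀ {Γ : List Entry} {n : ℕ}, (∀ {m : ℕ} {R : RTy}, Lookup Γ m R → m < n) →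
      ∀ (S : RTy) {m : ℕ} {R : RTy}, Lookup (.bind S :: Γ) m R → m < n + 1 := by
    intro Γ n hn S m R h
    cases h with
    | here => omega
    | bind h => have := hn h; omega
  have guard : ∀ {Γ : List Entry} {n : ℕ}, (∀ {m : ℕ} {R : RTy}, Lookup Γ m R → m < n) →
      ∀ (p : Tgt) {m : ℕ} {R : RTy}, Lookup (.guard p :: Γ) m R → m < n := by
    intro Γ n hn p m R h
    cases h with
    | guard h => exact hn h
  induction h generalizing n with
  | sub _ _ ih => exact ih hn
  | const c => trivial
  | var h => exact hn h
  | letin _ _ ih₁ ih₂ => exact ⟨ih₁ hn, ih₂ (bind hn _)⟩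
  | ite _ _ _ ih ih₁ ih₂ => exact ⟨ih hn, ih₁ (guard hn _), ih₂ (guard hn _)⟩
  | lam _ ih => exact ih (bind hn _)
  | app _ _ ih₁ ih₂ => exact ⟨ih₁ hn, ih₂ hn⟩
  | pair _ _ ih₁ ih₂ => exact ⟨ih₁ hn, ih₂ hn⟩
  | proj _ _ ih => exact ih hn
  | inj _ _ ih => exact ih hn
  | case _ _ _ ih ih₁ ih₂ => exact ⟨ih hn, ih₁ (bind hn _), ih₂ (bind hn _)⟩
  | dead _ ih => exact ih hn

theorem Checks.closed {t : Tgt} {R : RTy} (h : Checks [] t R) : t.Scoped 0 :=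
  h.scoped nofun

theorem Checks.const_inv {Γ : List Entry} {c : Const} {R : RTy} (h : Checks Γ (.const c) R) :
    Subtype Γ c.rty R := by
  generalize hs : Tgt.const c = s at h
  induction h with
  | sub _ h ih => exact (ih hs).trans h
  | const c => cases hs; exact .refl _ _
  | _ => cases hs

theorem Checks.lam_inv {Γ : List Entry} {t : Tgt} {S T : RTy} (h : Checks Γ (.lam t) (.pi S T)) :
    Checks (.bind S :: Γ) t T := by
  have key : ∀ {s : Tgt} {R : RTy}, Checks Γ s R → s = .lam t →
      ∃ S' T', Checks (.bind S' :: Γ) t T' ∧ Subtype Γ (.pi S' T') R := by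
    clear h
    intro s R h hs
    induction h with
    | sub _ h ih => obtain ⟨S', T', h₁, h₂⟩ := ih hs; exact ⟨S', T', h₁, h₂.trans h⟩
    | lam h => cases hs; exact ⟨_, _, h, .refl _ _⟩
    | _ => cases hs
  obtain ⟨S', T', h₁, h₂⟩ := key h rfl
  cases h₂ with
  | pi hS hT => exact .sub (h₁.narrow hS) hT

theorem Checks.pair_inv {Γ : List Entry} {t₁ t₂ : Tgt} {R₁ R₂ : RTy}
    (h : Checks Γ (.pair t₁ t₂) (.prod R₁ R₂)) : Checks Γ t₁ R₁ ∧ Checks Γ t₂ R₂ := by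
  have key : ∀ {s : Tgt} {R : RTy}, Checks Γ s R → s = .pair t₁ t₂ →
      ∃ S T, Checks Γ t₁ S ∧ Checks Γ t₂ T ∧ Subtype Γ (.prod S T) R := by
    clear h
    intro s R h hs
    induction h with
    | sub _ h ih => obtain ⟨S, T, h₁, h₂, h₃⟩ := ih hs; exact ⟨S, T, h₁, h₂, h₃.trans h⟩
    | pair h₁ h₂ => cases hs; exact ⟨_, _, h₁, h₂, .refl _ _⟩
    | _ => cases hs
  obtain ⟨S, T, h₁, h₂, h₃⟩ := key h rfl
  cases h₃ with
  | prod hS hT => exact ⟨.sub h₁ hS, .sub h₂ hT⟩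

theorem Checks.inj_inv {Γ : List Entry} {k : Side} {t : Tgt} {R₁ R₂ : RTy}
    (h : Checks Γ (.inj k t) (.sum R₁ R₂)) : Checks Γ t (k.pick R₁ R₂) := by
  have key : ∀ {s : Tgt} {R : RTy}, Checks Γ s R → s = .inj k t →
      ∃ S T, Checks Γ t (k.pick S T) ∧ Subtype Γ (.sum S T) R := by
    clear h
    intro s R h hs
    induction h with
    | sub _ h ih => obtain ⟨S, T, h₁, h₃⟩ := ih hs; exact ⟨S, T, h₁, h₃.trans h⟩
    | inj k h => cases hs; exact ⟨_, _, h, .refl _ _⟩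
    | _ => cases hs
  obtain ⟨S, T, h₁, h₂⟩ := key h rfl
  cases h₂ with
  | sum hS hT => cases k; exacts [.sub h₁ hS, .sub h₁ hT]

theorem Checks.exists_val_of_closed {t : Tgt} {R : RTy} (h : Checks [] t R) {σ : ℕ → Tgt}
    (hσ : Models [] σ) : ∃ w, Steps t w ∧ Val R σ w := by
  have := h.exists_val hσ
  rwa [Tgt.closed_subst h.closed] at this

theorem Checks.satMap_scons {w : Tgt} {S : RTy} (hw : Checks [] w S) (hv : w.IsValue) :
    SatMap [] (Tgt.scons w .var) [.bind S] := by
  intro τ hτ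
  have hM : Models [.bind S] (fun n => (Tgt.scons w .var n).subst τ) := by
    refine ⟨hτ, ?_⟩
    change Val S τ (w.subst τ)
    obtain ⟨u, h₁, h₂⟩ := hw.exists_val_of_closed hτ
    rwa [hv.steps_eq h₁, ← Tgt.closed_subst hw.closed τ] at h₂
  exact hM.sat

/-- Substitution of a closed value for the only variable.  A variable of primitive type is checked
against the type of the values equal to it, which becomes the type of the literal that replaces
it. -/
theorem Checks.inst {t w : Tgt} {S T : RTy} (h : Checks [.bind S] t T) (hw : Checks [] w S)
    (hv : w.IsValue) : Checks [] (t.inst w) (T.inst w) := by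
  refine h.subst ⟨fun hl => ?_, hw.satMap_scons hv⟩
  cases hl with
  | bind hl => cases hl
  | here =>
    have hw' := hw
    rw [← RTy.shift_inst S w] at hw'
    cases S with
    | base B p =>
      obtain ⟨σ, hσ⟩ := exists_models_nil
      obtain ⟨u, hu, ⟨a, rfl⟩, -⟩ := hw.exists_val_of_closed hσ
      obtain rfl := hv.steps_eq hu
      exact .const (Const.lit B a)
    | _ => exact hw'

/-- Type checking is preserved by evaluation. -/
theorem Checks.preservation {t t' : Tgt} {R : RTy} (h : Checks [] t R) (hs : FStep t t') :
    Checks [] t' R := by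
  generalize hΓ : ([] : List Entry) = Γ at h
  induction h generalizing t' with
  | sub _ h ih => exact .sub (ih hs hΓ) h
  | const | var | lam | pair => cases hs
  | @dead _ A B t h => subst hΓ; exact (not_checks_dead (.dead (B := B) h)).elim
  | letin h₁ h₂ ih₁ ih₂ =>
    subst hΓ
    cases hs with
    | cLetin hs => exact .letin (ih₁ hs rfl) h₂
    | letin hw => have := h₂.inst h₁ hw; rwa [RTy.shift_inst] at this
  | @ite _ t t₁ t₂ R h h₁ h₂ ih ih₁ ih₂ =>
    subst hΓ
    have closed := h.closed
    cases hs with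
    | @cIte _ t' _ _ hs =>
      have hsim : Sim t t' := .steps closed (.single hs)
      refine .ite (ih hs rfl) (h₁.of_guard .guard fun τ hτ => ⟨hτ.1, ?_⟩)
        (h₂.of_guard .guard fun τ hτ => ⟨hτ.1, ?_⟩)
      · exact (hsim.subst fun n => .refl _).holds_iff.2 hτ.2
      · exact ((Sim.app (.const _) hsim).subst fun n => .refl _).holds_iff.2 hτ.2
    | iteTrue => exact h₁.of_guard nofun fun τ hτ => ⟨hτ, holds_iff.2 .refl⟩
    | iteFalse =>
      exact h₂.of_guard nofun fun τ hτ => ⟨hτ, holds_iff.2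
        (.single (.prim (.mk .bool [] .bool (fun b : Bool => !b) false)))⟩
  | @app _ t₁ t₂ S T h₁ h₂ ih₁ ih₂ =>
    subst hΓ
    cases hs with
    | cAppL hs => exact .app (ih₁ hs rfl) h₂
    | cAppR hw hs =>
      refine .sub (.app h₁ (ih₂ hs rfl)) ?_
      exact (Sim.subtype_subst T
        (Sim.scons (.steps h₂.closed (.single hs)) fun n => .refl _) []).2
    | beta hw => exact h₁.lam_inv.inst h₂ hw
    | @prim c d r hp =>
      have hsim : Sim (.app (.const c) (.const d)) (.const r) :=
        .steps (show Tgt.Scoped 0 (.app (.const c) (.const d)) from ⟨trivial, trivial⟩)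
          (.single (.prim hp))
      have hc := h₁.const_inv
      cases hp with
      | mk A As B f a =>
        cases hc with
        | pi hS hT =>
          -- the codomains are compared under `S`, hence also at the argument
          have hT' : Subtype [] _ (T.inst (.const (Const.lit A a))) :=
            hT.subst (h₂.satMap_scons trivial)
          rw [selfTy_subst] at hT'
          refine .sub (.sub (.const _) ?_) hT'
          have := (Sim.subtype_subst (selfTy (.var 0) As B)
            (Sim.scons hsim fun n => .refl (.var n)) []).2
          rwa [selfTy_subst, selfTy_subst] at this
  | proj k h ih =>
    subst hΓ
    cases hs with
    | cProj hs => exact .proj k (ih hs rfl)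
    | proj => cases k; exacts [h.pair_inv.1, h.pair_inv.2]
  | inj k h ih =>
    subst hΓ
    cases hs with
    | cInj hs => exact .inj k (ih hs rfl)
  | case h h₁ h₂ ih ih₁ ih₂ =>
    subst hΓ
    cases hs with
    | cCase hs => exact .case (ih hs rfl) h₁ h₂
    | @case k w _ _ hw =>
      have h := h.inj_inv
      cases k with
      | one => have := h₁.inst h hw; rwa [RTy.shift_inst] at this
      | two => have := h₂.inst h hw; rwa [RTy.shift_inst] at this

/-! ### Elaboration -/

theorem Elaborates.rename {Γ : List Ty} {e : Src} {A : Ty} {t : Tgt} (h : Elaborates Γ e A t)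
    {Δ : List Ty} {ξ : ℕ → ℕ} (hξ : ∀ {n : ℕ} {A : Ty}, Γ[n]? = some A → Δ[ξ n]? = some A) :
    Elaborates Δ (e.rename ξ) A (t.rename ξ) := by
  have up : ∀ {Γ Δ : List Ty} {ξ : ℕ → ℕ},
      (∀ {n : ℕ} {A : Ty}, Γ[n]? = some A → Δ[ξ n]? = some A) → ∀ (B : Ty) {n : ℕ} {A : Ty},
      (B :: Γ)[n]? = some A → (B :: Δ)[upRen ξ n]? = some A := by
    intro Γ Δ ξ hξ B n A h
    cases n with
    | zero => exact h
    | succ n => exact hξ h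
  induction h generalizing Δ ξ with
  | const c => exact .const c
  | var h => exact .var (hξ h)
  | letin _ _ ih₁ ih₂ => exact .letin (ih₁ hξ) (ih₂ (up hξ _))
  | ite _ _ _ ih ih₁ ih₂ => exact .ite (ih hξ) (ih₁ hξ) (ih₂ hξ)
  | interIntro hv _ _ hw ih₁ ih₂ => exact .interIntro (hv.rename ξ) (ih₁ hξ) (ih₂ hξ) hw
  | interElim k _ ih => exact .interElim k (ih hξ)
  | lam hw _ ih => exact .lam hw (ih (up hξ _))
  | app _ _ ih₁ ih₂ => exact .app (ih₁ hξ) (ih₂ hξ)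
  | dead _ ht ih => exact .dead (ih hξ) ht
  | unionIntro k _ hw ih => exact .unionIntro k (ih hξ) hw
  | unionElim _ _ _ ih ih₁ ih₂ =>
    have ih₁ := ih₁ (up hξ _)
    have ih₂ := ih₂ (up hξ _)
    rw [SrcCtx.plug_rename, SrcCtx.shift_rename] at ih₁ ih₂
    rw [SrcCtx.plug_rename]
    exact .unionElim (ih hξ) ih₁ ih₂

/-- Simultaneous substitution of source values, and of their elaborations in the target term. -/
theorem Elaborates.subst {Γ : List Ty} {e : Src} {A : Ty} {t : Tgt} (h : Elaborates Γ e A t)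
    {Δ : List Ty} {σ : ℕ → Src} {τ : ℕ → Tgt} (hσ : ∀ n, (σ n).IsValue)
    (h' : ∀ {n : ℕ} {A : Ty}, Γ[n]? = some A → Elaborates Δ (σ n) A (τ n)) :
    Elaborates Δ (e.subst σ) A (t.subst τ) := by
  have up : ∀ {Γ Δ : List Ty} {σ : ℕ → Src} {τ : ℕ → Tgt},
      (∀ {n : ℕ} {A : Ty}, Γ[n]? = some A → Elaborates Δ (σ n) A (τ n)) →
      ∀ (B : Ty) {n : ℕ} {A : Ty}, (B :: Γ)[n]? = some A →
        Elaborates (B :: Δ) (Src.up σ n) A (Tgt.up τ n) := by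
    intro Γ Δ σ τ h' B n A h
    cases n with
    | zero => exact .var h
    | succ n => exact (h' h).rename id
  induction h generalizing Δ σ τ with
  | const c => exact .const c
  | var h => exact h' h
  | letin _ _ ih₁ ih₂ => exact .letin (ih₁ hσ h') (ih₂ (Src.up_isValue hσ) (up h' _))
  | ite _ _ _ ih ih₁ ih₂ => exact .ite (ih hσ h') (ih₁ hσ h') (ih₂ hσ h')
  | interIntro hv _ _ hw ih₁ ih₂ =>
    exact .interIntro (hv.subst hσ) (ih₁ hσ h') (ih₂ hσ h') hw
  | interElim k _ ih => exact .interElim k (ih hσ h')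
  | lam hw _ ih => exact .lam hw (ih (Src.up_isValue hσ) (up h' _))
  | app _ _ ih₁ ih₂ => exact .app (ih₁ hσ h') (ih₂ hσ h')
  | dead _ ht ih => exact .dead (ih hσ h') ht
  | unionIntro k _ hw ih => exact .unionIntro k (ih hσ h') hw
  | unionElim _ _ _ ih ih₁ ih₂ =>
    have ih₁ := ih₁ (Src.up_isValue hσ) (up h' _)
    have ih₂ := ih₂ (Src.up_isValue hσ) (up h' _)
    rw [SrcCtx.plug_subst _ _ (Src.up_isValue hσ), SrcCtx.shift_subst_up _ hσ] at ih₁ ih₂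
    rw [SrcCtx.plug_subst _ _ hσ]
    exact .unionElim (ih hσ h') ih₁ ih₂

theorem Elaborates.inst {Γ : List Ty} {e v : Src} {A B : Ty} {t w : Tgt}
    (h : Elaborates (A :: Γ) e B t) (hv : v.IsValue) (h' : Elaborates Γ v A w) :
    Elaborates Γ (e.inst v) B (t.inst w) := by
  refine h.subst (fun n => ?_) (fun {n} _ hn => ?_)
  · cases n with
    | zero => exact hv
    | succ n => trivial
  · cases n with
    | zero => obtain rfl := Option.some.inj hn; exact h'
    | succ n => exact .var hn

theorem Elaborates.isValue {Γ : List Ty} {e : Src} {A : Ty} {t : Tgt} (h : Elaborates Γ e A t)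
    (ht : t.IsValue) : e.IsValue := by
  induction h with
  | const | var | lam => trivial
  | interIntro hv => exact hv
  | dead _ _ ih => exact ih ht
  | unionIntro _ _ _ ih => exact ih ht
  | _ => exact ht.elim

theorem Elaborates.const_inv {Γ : List Ty} {e : Src} {A : Ty} {c : Const}
    (h : Elaborates Γ e A (.const c)) : e = .const c ∧ A = c.ty := by
  cases h with
  | const => exact ⟨rfl, rfl⟩

/-- A target step either leaves the source term that elaborates to the target term as it is, or is
matched by one step of it.  The source is left alone by the projections and case distinctions that
elaboration inserts, because `E[v]` is obtained by substituting `v` in `E[x]`. -/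
theorem Elaborates.step {Γ : List Ty} {e : Src} {A : Ty} {t t' : Tgt} (h : Elaborates Γ e A t)
    (hs : FStep t t') : ∃ e', (e' = e ∨ SrcStep e e') ∧ Elaborates Γ e' A t' := by
  have ctx : ∀ {e e' : Src} (E : SrcCtx), (e' = e ∨ SrcStep e e') →
      E.plug e' = E.plug e ∨ SrcStep (E.plug e) (E.plug e') := by
    rintro e e' E (rfl | h)
    · exact .inl rfl
    · exact .inr (.ctx E h)
  induction h generalizing t' with
  | const | var | lam | interIntro => cases hs
  | letin h₁ h₂ ih₁ =>
    cases hs with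
    | cLetin hs =>
      obtain ⟨e', he, h⟩ := ih₁ hs
      exact ⟨_, ctx (.letin .hole _) he, .letin h h₂⟩
    | letin hw =>
      have hv := h₁.isValue hw
      exact ⟨_, .inr (.letin hv), h₂.inst hv h₁⟩
  | ite h h₁ h₂ ih =>
    cases hs with
    | cIte hs =>
      obtain ⟨e', he, h⟩ := ih hs
      exact ⟨_, ctx (.ite .hole _ _) he, .ite h h₁ h₂⟩
    | iteTrue => obtain ⟨rfl, -⟩ := h.const_inv; exact ⟨_, .inr .iteTrue, h₁⟩
    | iteFalse => obtain ⟨rfl, -⟩ := h.const_inv; exact ⟨_, .inr .iteFalse, h₂⟩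
  | interElim k h ih =>
    cases hs with
    | cProj hs =>
      obtain ⟨e', he, h⟩ := ih hs
      exact ⟨e', he, .interElim k h⟩
    | proj =>
      generalize hA : Ty.and _ _ = T at h
      cases h with
      | interIntro _ h₁ h₂ => cases hA; cases k; exacts [⟨_, .inl rfl, h₁⟩, ⟨_, .inl rfl, h₂⟩]
  | app h₁ h₂ ih₁ ih₂ =>
    cases hs with
    | cAppL hs =>
      obtain ⟨e', he, h⟩ := ih₁ hs
      exact ⟨_, ctx (.appL .hole _) he, .app h h₂⟩
    | cAppR hw hs =>
      obtain ⟨e', he, h⟩ := ih₂ hs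
      exact ⟨_, ctx (.appR _ (h₁.isValue hw) .hole) he, .app h₁ h⟩
    | prim hp =>
      obtain ⟨rfl, hA⟩ := h₁.const_inv
      obtain ⟨rfl, -⟩ := h₂.const_inv
      refine ⟨_, .inr (.prim hp), ?_⟩
      cases hp with
      | mk A As B f a => cases hA; exact .const _
    | beta hw =>
      have hv := h₂.isValue hw
      generalize hA : Ty.arr _ _ = T at h₁
      cases h₁ with
      | lam _ h => cases hA; exact ⟨_, .inr (.beta hv), h.inst hv h₂⟩
  | dead _ ht ih =>
    cases hs with
    | cDead hs =>
      obtain ⟨e', he, h⟩ := ih hs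
      exact ⟨e', he, .dead h ht⟩
  | unionIntro k _ hw ih =>
    cases hs with
    | cInj hs =>
      obtain ⟨e', he, h⟩ := ih hs
      exact ⟨e', he, .unionIntro k h hw⟩
  | @unionElim Γ E _ _ _ _ _ _ _ h h₁ h₂ ih =>
    cases hs with
    | cCase hs =>
      obtain ⟨e', he, h⟩ := ih hs
      exact ⟨_, ctx E he, .unionElim h h₁ h₂⟩
    | @case k _ _ _ hw =>
      refine ⟨_, .inl rfl, ?_⟩
      generalize hA : Ty.or _ _ = T at h
      cases h with
      | unionIntro _ h _ =>
        cases hA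
        have hv := h.isValue hw
        rw [← SrcCtx.plug_shift_inst E]
        cases k with
        | one => exact h₁.inst hv h
        | two => exact h₂.inst hv h

/-! ### Two-phase soundness -/

theorem Src.IsValue.not_srcStep {v e : Src} (hv : v.IsValue) : ¬ SrcStep v e := by
  intro h
  induction h with
  | ctx E _ ih => cases E with
    | hole => exact ih hv
    | _ => exact hv
  | _ => exact hv

theorem SrcStep.not_isValue {e e' : Src} (h : SrcStep e e') : ¬ e.IsValue :=
  fun hv => hv.not_srcStep h

/-- A source step, inverted according to the form of the term that takes it. -/
theorem SrcStep.inv {e e' : Src} (h : SrcStep e e') :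
    match e with
    | .const _ | .var _ | .lam _ => False
    | .letin e₁ e₂ => (e₁.IsValue ∧ e' = e₂.inst e₁) ∨ ∃ e₁', SrcStep e₁ e₁' ∧ e' = .letin e₁' e₂
    | .ite e₀ e₁ e₂ => (e₀ = .const (Const.ofBool true) ∧ e' = e₁) ∨
        (e₀ = .const (Const.ofBool false) ∧ e' = e₂) ∨ ∃ e₀', SrcStep e₀ e₀' ∧ e' = .ite e₀' e₁ e₂
    | .app e₁ e₂ => (∃ e₁', SrcStep e₁ e₁' ∧ e' = .app e₁' e₂) ∨
        (e₁.IsValue ∧ ∃ e₂', SrcStep e₂ e₂' ∧ e' = .app e₁ e₂') ∨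
        (e₂.IsValue ∧ ∃ e₃, e₁ = .lam e₃ ∧ e' = e₃.inst e₂) ∨
        ∃ c d r, PrimApp c d r ∧ e₁ = .const c ∧ e₂ = .const d ∧ e' = .const r := by
  induction h with
  | ctx E h ih =>
    cases E with
    | hole => exact ih
    | letin E e => exact .inr ⟨_, .ctx E h, rfl⟩
    | ite E e₁ e₂ => exact .inr (.inr ⟨_, .ctx E h, rfl⟩)
    | appL E e => exact .inl ⟨_, .ctx E h, rfl⟩
    | appR v hv E => exact .inr (.inl ⟨hv, _, .ctx E h, rfl⟩)
  | prim h => exact .inr (.inr (.inr ⟨_, _, _, h, rfl, rfl, rfl⟩))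
  | beta hv => exact .inr (.inr (.inl ⟨hv, _, rfl, rfl⟩))
  | iteTrue => exact .inl ⟨rfl, rfl⟩
  | iteFalse => exact .inr (.inl ⟨rfl, rfl⟩)
  | letin hv => exact .inl ⟨hv, rfl⟩

theorem SrcStep.det {e e₁ e₂ : Src} (hs₁ : SrcStep e e₁) (hs₂ : SrcStep e e₂) : e₁ = e₂ := by
  induction e generalizing e₁ e₂ with
  | const | var | lam => exact hs₁.inv.elim
  | letin a b iha ihb =>
    obtain ⟨hv, rfl⟩ | ⟨a₁, h₁, rfl⟩ := hs₁.inv <;> obtain ⟨hv', rfl⟩ | ⟨a₂, h₂, rfl⟩ := hs₂.inv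
    · rfl
    · exact (h₂.not_isValue hv).elim
    · exact (h₁.not_isValue hv').elim
    · rw [iha h₁ h₂]
  | ite a b c iha ihb ihc =>
    have tf : Src.const (Const.ofBool true) ≠ .const (Const.ofBool false) := fun h =>
      absurd (Const.ofBool_injective (Src.const.inj h)) (by simp)
    obtain ⟨rfl, rfl⟩ | ⟨rfl, rfl⟩ | ⟨a₁, h₁, rfl⟩ := hs₁.inv <;>
      obtain ⟨h, rfl⟩ | ⟨h, rfl⟩ | ⟨a₂, h₂, rfl⟩ := hs₂.inv
    · rfl
    · exact (tf h).elim
    · exact (h₂.not_isValue trivial).elim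
    · exact (tf h.symm).elim
    · rfl
    · exact (h₂.not_isValue trivial).elim
    · subst h; exact (h₁.not_isValue trivial).elim
    · subst h; exact (h₁.not_isValue trivial).elim
    · rw [iha h₁ h₂]
  | app a b iha ihb =>
    obtain ⟨a₁, h₁, rfl⟩ | ⟨hv, b₁, h₁, rfl⟩ | ⟨hv, s, rfl, rfl⟩ | ⟨c, d, r, hp, rfl, rfl, rfl⟩ :=
      hs₁.inv <;>
    obtain ⟨a₂, h₂, rfl⟩ | ⟨hv', b₂, h₂, rfl⟩ | ⟨hv', s', h, rfl⟩ |
      ⟨c', d', r', hp', h, h', rfl⟩ := hs₂.inv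
    · rw [iha h₁ h₂]
    · exact (h₁.not_isValue hv').elim
    · subst h; exact (h₁.not_isValue trivial).elim
    · subst h; exact (h₁.not_isValue trivial).elim
    · exact (h₂.not_isValue hv).elim
    · rw [ihb h₁ h₂]
    · exact (h₁.not_isValue hv').elim
    · subst h'; exact (h₁.not_isValue trivial).elim
    · exact (h₂.not_isValue trivial).elim
    · exact (h₂.not_isValue hv).elim
    · cases h; rfl
    · cases h
    · exact (h₂.not_isValue trivial).elim
    · exact (h₂.not_isValue trivial).elim
    · cases h
    · cases h; cases h'; rw [hp.det hp']

/-- The target term evaluates to a value, and a term elaborating to a value is a value.  So a source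
term that is no value has to take a step during that evaluation. -/
theorem Elaborates.progress {e : Src} {A : Ty} {t : Tgt} {R : RTy} (h : Elaborates [] e A t)
    (hc : Checks [] t R) : e.IsValue ∨ ∃ e' t', SrcStep e e' ∧ Elaborates [] e' A t' ∧
      Relation.TransGen FStep t t' ∧ Checks [] t' R := by
  obtain ⟨σ, hσ⟩ := exists_models_nil
  obtain ⟨w, hw, hv⟩ := hc.exists_val_of_closed hσ
  replace hv := hv.closed_value.1
  induction hw using Relation.ReflTransGen.head_induction_on with
  | refl => exact .inl (h.isValue hv)
  | head hs _ ih =>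
    have hc' := hc.preservation hs
    obtain ⟨e', rfl | he, h'⟩ := h.step hs
    · obtain hv | ⟨e'', t'', h₁, h₂, h₃, h₄⟩ := ih h' hc'
      · exact .inl hv
      · exact .inr ⟨e'', t'', h₁, h₂, .head hs h₃, h₄⟩
    · exact .inr ⟨e', _, he, h', .single hs, hc'⟩

theorem WellTwoTyped.progress {e : Src} (h : WellTwoTyped e) :
    e.IsValue ∨ ∃ e', SrcStep e e' ∧ WellTwoTyped e' := by
  obtain ⟨A, t, R, he, hc⟩ := h
  obtain hv | ⟨e', t', h₁, h₂, -, h₄⟩ := he.progress hc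
  · exact .inl hv
  · exact .inr ⟨e', h₁, A, t', R, h₂, h₄⟩

theorem WellTwoTyped.steps {e e' : Src} (h : WellTwoTyped e)
    (hs : Relation.ReflTransGen SrcStep e e') : WellTwoTyped e' := by
  induction hs with
  | refl => exact h
  | tail _ hs ih =>
    obtain hv | ⟨e'', h₁, h₂⟩ := ih.progress
    · exact (hv.not_srcStep hs).elim
    · rwa [hs.det h₁]

end TwoPhase

theorem mainTheorem3 :
    -- progress and preservation
    (∀ e : TwoPhase.Src, TwoPhase.WellTwoTyped e →
      e.IsValue ∨ ∃ e' : TwoPhase.Src, TwoPhase.SrcStep e e' ∧ TwoPhase.WellTwoTyped e') ∧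
    -- in more detail: both types are preserved, and the target makes a matching nonempty run
    (∀ (e : TwoPhase.Src) (A : TwoPhase.Ty) (t : TwoPhase.Tgt) (R : TwoPhase.RTy),
      TwoPhase.Elaborates [] e A t → TwoPhase.Checks [] t R →
      e.IsValue ∨ ∃ (e' : TwoPhase.Src) (t' : TwoPhase.Tgt),
        TwoPhase.SrcStep e e' ∧ TwoPhase.Elaborates [] e' A t' ∧
        Relation.TransGen TwoPhase.TgtStep t t' ∧ TwoPhase.Checks [] t' R) ∧
    -- DEAD-casts have no refinement type in the empty environment
    (∀ (A B : TwoPhase.Ty) (t : TwoPhase.Tgt) (R : TwoPhase.RTy),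
      ¬ TwoPhase.Checks [] (.dead A B t) R) ∧
    -- well two-typed terms never get stuck
    (∀ e e' : TwoPhase.Src, TwoPhase.WellTwoTyped e →
      Relation.ReflTransGen TwoPhase.SrcStep e e' →
      e'.IsValue ∨ ∃ e'' : TwoPhase.Src, TwoPhase.SrcStep e' e'') := by
  refine ⟨fun e h => h.progress, fun e A t R he hc => ?_,
    fun A B t R => TwoPhase.not_checks_dead, fun e e' h hs => ?_⟩
  · rw [TwoPhase.tgtStep_eq_fStep]
    exact he.progress hc
  · exact (h.steps hs).progress.imp_right fun ⟨e'', h, _⟩ => ⟨e'', h⟩
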